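/- Let $d\ge 1$ and $\mathcal H=\mathcal H_A\otimes\mathcal H_B\otimes\mathcal H_C$ with $\dim\mathcal H_A=\dim\mathcal H_B=\dim\mathcal H_C=d$, and put $D=d^3$. Let $\rho$ be any density matrix on $\mathcal H$, and let $U_A,U_B,U_C$ be independent random unitaries, each drawn from a unitary $4$-design on $\mathbb C^d$ (for instance from the Haar measure). Put $U=U_A\otimes U_B\otimes U_C$. Given $U$, let $\hat s(1),\dots,\hat s(N_M)$ be independent computational-basis outcomes $\hat s=(\hat s_A,\hat s_B,\hat s_C)\in\{0,\dots,d-1\}^3$ with law $\Pr(s|U)=\langle s|U\rho U^\dagger|s\rangle$. Let $X(a,a')=-(-d)^{\delta_{a,a'}}$ and, for $I=(i,j,k,l)$ with $1\le i<j<k<l\le N_M$, $$q_I=X(\hat s_A(i),\hat s_A(j))\,X(\hat s_B(i),\hat s_B(k))\,X(\hat s_C(i),\hat s_C(l)),\qquad \hat M=\binom{N_M}{4}^{-1}\sum_I q_I .$$ For a pair $I=(i,j,k,l)$, $I'=(i',j',k',l')$ of such quadruples, a coincidence is an index common to both. For a set of pairs, its contribution is $\binom{N_M}{4}^{-2}\sum_{(I,I')}\mathbb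 E[q_Iq_{I'}]$, summed over that set. Let $\Gamma_8$ and $\Gamma_4$ be the contributions of the pairs with no coincidence and with four coincidences. For $m=7,6,5$ and $r=0,1,2$, let $\Gamma_m^{(r)}$ be the contribution of the pairs with exactly $8-m$ coincidences in which exactly $r$ of the two leading indices $i,i'$ take part in a coincidence. (a) Decomposition: for all $d\ge 1$, all $N_M$, and all $\rho$ and ensembles as above, $$\mathbb E[\hat M^2]=\Gamma_8+\sum_{m=5}^{7}\sum_{r=0}^{2}\Gamma_m^{(r)}+\Gamma_4 .$$ (b) There are absolute constants $c,C>0$ such that, for all $d\ge1$, all $N_M\ge 4$, and all $\rho$ and ensembles as above, $$|\Gamma_8|,\ |\Gamma_7^{(2)}|,\ |\Gamma_7^{(1)}|,\ |\Gamma_7^{(0)}|,\ |\Gamma_6^{(1)}|,\ |\Gamma_6^{(0)}|,\ |\Gamma_5^{(1)}|,\ |\Gamma_5^{(0)}|\ \le\ C,$$ $$|\Gamma_6^{(2)}|\le C\,D^{1/3},\qquad |\Gamma_5^{(2)}|\le C\,D^{2/3},\qquad c\,\frac{D}{\binom{N_M}{4}}\le\Gamma_4\le C\,\frac{D}{\binom{N_M}{4}}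 .$$ In particular $\Gamma_4=\Theta(D)$ for fixed $N_M$. (c) The term $\Gamma_4$ dominates as $D\to\infty$: for every $N_M\ge4$ and $\varepsilon>0$ there is $d_0$, depending only on $N_M$ and $\varepsilon$, such that for all $d\ge d_0$ and all $\rho$ and ensembles as above $$|\Gamma_8|+\sum_{m=5}^{7}\sum_{r=0}^{2}|\Gamma_m^{(r)}|\le\varepsilon\,\Gamma_4 .$$ -/

import Mathlib

open scoped Matrix Kronecker ComplexOrder
open MeasureTheory

noncomputable section

namespace CorrelationOverlap

/-! ### The compact group of `d × d` unitary matrices and unitary designs -/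

/-- The group of unitary `d × d` complex matrices. -/
abbrev UGroup (d : ℕ) : Type := Matrix.unitaryGroup (Fin d) ℂ

instance instMeasurableSpaceUGroup (d : ℕ) : MeasurableSpace (UGroup d) := borel _

instance instBorelSpaceUGroup (d : ℕ) : BorelSpace (UGroup d) := ⟨rfl⟩

instance instSecondCountableUGroup (d : ℕ) : SecondCountableTopology (UGroup d) := by
  have : SecondCountableTopology (Matrix (Fin d) (Fin d) ℂ) :=
    inferInstanceAs (SecondCountableTopology (Fin d → Fin d → ℂ))
  exact TopologicalSpace.Subtype.secondCountableTopology _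

instance instCompactSpaceUGroup (d : ℕ) : CompactSpace (UGroup d) := by
  refine isCompact_iff_compactSpace.mp ?_
  have hK : IsCompact (Set.univ.pi fun _ : Fin d => Set.univ.pi fun _ : Fin d =>
      Metric.closedBall (0 : ℂ) 1) :=
    isCompact_univ_pi fun _ => isCompact_univ_pi fun _ => isCompact_closedBall 0 1
  refine IsCompact.of_isClosed_subset (X := Fin d → Fin d → ℂ) hK ?_ ?_
  · have h : IsClosed {U : Matrix (Fin d) (Fin d) ℂ | star U * U = 1 ∧ U * star U = 1} :=
      (isClosed_eq (by fun_prop) (by fun_prop)).inter (isClosed_eq (by fun_prop) (by fun_prop))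
    exact h
  · intro U hU i _ j _
    simpa using entry_norm_bound_of_unitary hU i j

/-- The normalized Haar measure on the unitary group. -/
def haarU (d : ℕ) : Measure (UGroup d) := Measure.haarMeasure ⊤

/-- The tensor power `M^{⊗ t}`, a matrix on `(ℂ^d)^{⊗ t}` with basis `Fin t → Fin d`. -/
def tensorPow {d : ℕ} (t : ℕ) (M : Matrix (Fin d) (Fin d) ℂ) :
    Matrix (Fin t → Fin d) (Fin t → Fin d) ℂ :=
  Matrix.of fun a b => ∏ m, M (a m) (b m)

/-- The `t`-fold twirling `O ↦ 𝔼_U [U^{⊗ t} O (U^{⊗ t})†]` over the distribution `μ` of `U`. -/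
def twirl {d : ℕ} (μ : Measure (UGroup d)) (t : ℕ)
    (O : Matrix (Fin t → Fin d) (Fin t → Fin d) ℂ) :
    Matrix (Fin t → Fin d) (Fin t → Fin d) ℂ :=
  Matrix.of fun a b =>
    ∫ U : UGroup d, (tensorPow t (U : Matrix (Fin d) (Fin d) ℂ) * O *
      (tensorPow t (U : Matrix (Fin d) (Fin d) ℂ))ᴴ) a b ∂μ

/-- `μ` is a unitary `t`-design: a probability distribution on the unitary group whose `t`-fold
twirling agrees with that of the Haar measure. Finite ensembles are included (as averages of
Dirac masses), and so is the Haar measure itself. -/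
structure IsUnitaryDesign {d : ℕ} (t : ℕ) (μ : Measure (UGroup d)) : Prop where
  isProbabilityMeasure : IsProbabilityMeasure μ
  twirl_eq : ∀ O : Matrix (Fin t → Fin d) (Fin t → Fin d) ℂ, twirl μ t O = twirl (haarU d) t O

/-! ### States and the measurement record -/

/-- Labels `(a, b, c)` of the computational basis of `ℋ_A ⊗ ℋ_B ⊗ ℋ_C`, each of dimension `d`;
also the set of outcomes of one measurement. -/
abbrev Outcome (d : ℕ) : Type := Fin d × Fin d × Fin d

/-- Density matrices on `ℋ_A ⊗ ℋ_B ⊗ ℋ_C`. -/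
structure IsState {d : ℕ} (ρ : Matrix (Outcome d) (Outcome d) ℂ) : Prop where
  posSemidef : ρ.PosSemidef
  trace_eq_one : ρ.trace = 1

/-- A choice of the three local unitaries `(U_A, U_B, U_C)`. -/
abbrev LocalUnitary (d : ℕ) : Type := UGroup d × UGroup d × UGroup d

/-- The matrix `U_A ⊗ U_B ⊗ U_C`. -/
def LocalUnitary.toMatrix {d : ℕ} (U : LocalUnitary d) : Matrix (Outcome d) (Outcome d) ℂ :=
  (U.1 : Matrix (Fin d) (Fin d) ℂ) ⊗ₖ
    ((U.2.1 : Matrix (Fin d) (Fin d) ℂ) ⊗ₖ (U.2.2 : Matrix (Fin d) (Fin d) ℂ))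

/-- The Born probability `Pr(s | U) = ⟨s| U ρ U† |s⟩`. -/
def born {d : ℕ} (ρ : Matrix (Outcome d) (Outcome d) ℂ) (U : LocalUnitary d) (s : Outcome d) : ℝ :=
  ((U.toMatrix * ρ * U.toMatrixᴴ) s s).re

/-- The expectation `𝔼_{s,U} f(s)` of a function of the record `s = (s(1), …, s(N))`:
`U = (U_A, U_B, U_C)` is drawn from `μA ⊗ μB ⊗ μC` and, given `U`, the `N` outcomes are
independent with law `Pr(· | U)`. -/
def expect {d : ℕ} (N : ℕ) (μA μB μC : Measure (UGroup d))
    (ρ : Matrix (Outcome d) (Outcome d) ℂ) (f : (Fin N → Outcome d) → ℝ) : ℝ :=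
  ∫ U : LocalUnitary d, ∑ s : Fin N → Outcome d, (∏ n, born ρ U (s n)) * f s
    ∂(μA.prod (μB.prod μC))

/-! ### The estimator -/

/-- `X(a, a') = -(-d)^{δ_{a,a'}}`. -/
def X {d : ℕ} (a a' : Fin d) : ℝ := -(-(d : ℝ)) ^ (if a = a' then 1 else 0)

/-- The post-processing function
`tr[Q |s₁⟩⟨s₁| ⊗ |s₂⟩⟨s₂| ⊗ |s₃⟩⟨s₃| ⊗ |s₄⟩⟨s₄|]` of four outcomes, where
`Q = X_A^{(1,2)} ⊗ X_B^{(1,3)} ⊗ X_C^{(1,4)}` is diagonal in the computational basis. -/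
def kernelQ {d : ℕ} (s₁ s₂ s₃ s₄ : Outcome d) : ℝ :=
  X s₁.1 s₂.1 * X s₁.2.1 s₃.2.1 * X s₁.2.2 s₄.2.2

/-- The index quadruples `I = (i, j, k, l)` with `i < j < k < l`. -/
def quads (N : ℕ) : Finset (Fin 4 → Fin N) :=
  Finset.univ.filter fun I => I 0 < I 1 ∧ I 1 < I 2 ∧ I 2 < I 3

/-- The value `tr[Q r̂(i) ⊗ r̂(j) ⊗ r̂(k) ⊗ r̂(l)]` on the record `s`. -/
def sample {d N : ℕ} (I : Fin 4 → Fin N) (s : Fin N → Outcome d) : ℝ :=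
  kernelQ (s (I 0)) (s (I 1)) (s (I 2)) (s (I 3))

/-- The estimator `M̂` built from the `N` outcomes obtained with one random unitary. -/
def estimator {d N : ℕ} (s : Fin N → Outcome d) : ℝ :=
  ((N.choose 4 : ℕ) : ℝ)⁻¹ * ∑ I ∈ quads N, sample I s

/-! ### Classification of the pairs of quadruples by coincidences -/

/-- The number of coincidences of `I = (i,j,k,l)` and `I' = (i',j',k',l')`, i.e. of indices
common to both. -/
def coincidences {N : ℕ} (I I' : Fin 4 → Fin N) : ℕ :=
  (Finset.univ.image I ∩ Finset.univ.image I').card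

/-- How many of the two leading indices `i`, `i'` take part in a coincidence. -/
def leading {N : ℕ} (I I' : Fin 4 → Fin N) : ℕ :=
  (if ∃ b, I 0 = I' b then 1 else 0) + (if ∃ a, I a = I' 0 then 1 else 0)

/-- The contribution to `𝔼_U 𝔼_s M̂²` of a set `P` of pairs of quadruples. -/
def contribution {d : ℕ} (N : ℕ) (μA μB μC : Measure (UGroup d))
    (ρ : Matrix (Outcome d) (Outcome d) ℂ) (P : (Fin 4 → Fin N) → (Fin 4 → Fin N) → Prop)
    [∀ I I', Decidable (P I I')] : ℝ :=
  (((N.choose 4 : ℕ) : ℝ) ^ 2)⁻¹ *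
    ∑ p ∈ (quads N ×ˢ quads N).filter (fun p => P p.1 p.2),
      expect N μA μB μC ρ fun s => sample p.1 s * sample p.2 s

/-- `Γ_m`: the contribution of the pairs with exactly `m` different indices, that is with
`8 - m` coincidences (`m ≤ 8`). -/
def Gam {d : ℕ} (m N : ℕ) (μA μB μC : Measure (UGroup d))
    (ρ : Matrix (Outcome d) (Outcome d) ℂ) : ℝ :=
  contribution N μA μB μC ρ fun I I' => coincidences I I' + m = 8

/-- `Γ_m^{(r)}`: the part of `Γ_m` in which exactly `r` of the two leading indices `i`, `i'`
take part in a coincidence. -/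
def GamLead {d : ℕ} (m r N : ℕ) (μA μB μC : Measure (UGroup d))
    (ρ : Matrix (Outcome d) (Outcome d) ℂ) : ℝ :=
  contribution N μA μB μC ρ fun I I' => coincidences I I' + m = 8 ∧ leading I I' = r

end CorrelationOverlap

end

open CorrelationOverlap

noncomputable section

namespace CorrelationOverlap

/-! ### Averages over the unitary group -/

section Haar

variable {d : ℕ}

/-! Upper bounds. Averaging over the unitaries turns E[q_I q_{I'}] into a pairing of ρ^{⊗N} with Φ_A
⊗ Φ_B ⊗ Φ_C, where each Φ is the twirl of a product of two kernels X. Such a Φ is a combination of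
permutations of the N copies. If its coefficients have total absolute size K, then the expectation
is at most K_A K_B K_C for every state (`abs_expect_le`). Since X = -1 + (d+1)δ, the sizes follow
from those of averaged δ's: one δ has size O(1/d), and a product of two δ's on different pairs has
size O(1/d²). Hence K = O(1) for two kernels on different pairs of copies, and K = O(d) on the same
pair, because X² = 1 + (d²-1)δ (`permBounded_X_mul_X`). Two kernels can share a pair only when i =
i', and n coincidences then allow at most n - 1 shared pairs. This gives the exponents of d, and
O(1) whenever the leading indices do not both coincide.

Uniformity in d. Inverting the Gram matrix of permutations fails for d < 4. The moments are instead
computed from the infinitesimal invariance of Haar measure (`rowDerivation_eq_zero`), which gives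
recursions with harmless denominators: `mean_row_recursion` for one row and `sum_mean_two_rows` for
two. A 4-design suffices for any N, because copies on which an observable does not depend drop out
by unitarity.

Lower bound. Four coincidences force I = I', so only squares enter Γ₄. For each fixed U,
conditioning on the leading outcome w factorizes the mean of q_I² into A(w)B(w)C(w). Four-term AM-GM
together with E[1/A], E[1/B], E[1/C] ≤ 1/d gives at least d³ (`cube_le_sum_sample_sq`). -/

instance instIsProbabilityMeasureHaarU (d : ℕ) : IsProbabilityMeasure (haarU d) :=
  ⟨by simpa [haarU] using Measure.haarMeasure_self (K₀ := (⊤ : TopologicalSpace.PositiveCompacts (UGroup d)))⟩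

instance instIsMulLeftInvariantHaarU (d : ℕ) : (haarU d).IsMulLeftInvariant := by
  unfold haarU; infer_instance

/-- The matrix element `U ↦ U r x` as a continuous function on the unitary group. -/
def entry (r x : Fin d) : C(UGroup d, ℂ) :=
  ⟨fun U => (U : Matrix (Fin d) (Fin d) ℂ) r x,
    (continuous_apply_apply r x).comp continuous_subtype_val⟩

@[simp] lemma entry_apply (r x : Fin d) (U : UGroup d) :
    entry r x U = (U : Matrix (Fin d) (Fin d) ℂ) r x := rfl

/-- Averaging over `μ`, as a continuous linear functional. -/
def mean (μ : Measure (UGroup d)) [IsFiniteMeasure μ] : C(UGroup d, ℂ) →L[ℂ] ℂ :=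
  LinearMap.mkContinuous
    { toFun := fun f => ∫ U, f U ∂μ
      map_add' := fun f g => integral_add
        (f.continuous.integrable_of_hasCompactSupport (HasCompactSupport.of_compactSpace _))
        (g.continuous.integrable_of_hasCompactSupport (HasCompactSupport.of_compactSpace _))
      map_smul' := fun c f => integral_const_mul c _ } (μ.real Set.univ)
    (fun f => by
      rw [mul_comm]
      exact norm_integral_le_of_norm_le_const (Filter.Eventually.of_forall f.norm_coe_le_norm))

lemma mean_apply (μ : Measure (UGroup d)) [IsFiniteMeasure μ] (f : C(UGroup d, ℂ)) :
    mean μ f = ∫ U, f U ∂μ := rfl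

lemma mean_one (μ : Measure (UGroup d)) [IsProbabilityMeasure μ] : mean μ 1 = 1 := by
  simp [mean_apply]

/-- The columns of a unitary matrix are orthonormal. -/
lemma sum_entry_mul_star (x y : Fin d) :
    ∑ c, entry c x * star (entry c y) = if x = y then 1 else 0 := by
  ext U
  have h : (star (U : Matrix (Fin d) (Fin d) ℂ) * (U : Matrix (Fin d) (Fin d) ℂ)) y x
      = (1 : Matrix (Fin d) (Fin d) ℂ) y x := by
    rw [Matrix.UnitaryGroup.star_mul_self]
  rw [Matrix.mul_apply, Matrix.one_apply] at h
  simp only [Matrix.star_apply] at h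
  simp only [ContinuousMap.sum_apply, ContinuousMap.mul_apply, ContinuousMap.star_apply,
    entry_apply]
  rw [Finset.sum_congr rfl fun c _ => mul_comm _ _, h]
  by_cases hxy : x = y
  · simp [hxy]
  · simp [hxy, Ne.symm hxy]

/-- The matrix elements of `W * U`. -/
def rowMul (W : Matrix (Fin d) (Fin d) ℂ) (r x : Fin d) : C(UGroup d, ℂ) :=
  ∑ q, W r q • entry q x

lemma rowMul_one (r x : Fin d) : rowMul 1 r x = entry r x := by
  simp [rowMul, Matrix.one_apply]

lemma rowMul_apply (W : UGroup d) (r x : Fin d) (U : UGroup d) :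
    rowMul (W : Matrix (Fin d) (Fin d) ℂ) r x U = entry r x (W * U) := by
  simp [rowMul, Matrix.mul_apply]

variable {ι : Type*}

lemma mean_haarU_rowMul (S : Finset ι) (r s x y : ι → Fin d) (W : UGroup d) :
    mean (haarU d) ((∏ m ∈ S, rowMul W (r m) (x m)) * ∏ m ∈ S, star (rowMul W (s m) (y m))) =
      mean (haarU d) ((∏ m ∈ S, entry (r m) (x m)) * ∏ m ∈ S, star (entry (s m) (y m))) := by
  rw [mean_apply, mean_apply]
  refine Eq.trans (integral_congr_ae (Filter.Eventually.of_forall fun U => ?_))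
    (integral_mul_left_eq_self (μ := haarU d) _ W)
  simp [ContinuousMap.prod_apply, rowMul_apply, -entry_apply]

variable [DecidableEq ι]

/-- The action of `H` on the rows, summed over the factors of a product of matrix elements, minus
the dual action on the conjugated factors. -/
def rowDerivation (S : Finset ι) (r s x y : ι → Fin d) (H : Matrix (Fin d) (Fin d) ℂ) : ℂ :=
  mean (haarU d)
    ((∑ n ∈ S, (∏ m ∈ S.erase n, entry (r m) (x m)) * rowMul H (r n) (x n)) *
        (∏ m ∈ S, star (entry (s m) (y m))) -
      (∏ m ∈ S, entry (r m) (x m)) *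
        ∑ n ∈ S, (∏ m ∈ S.erase n, star (entry (s m) (y m))) *
          ∑ q, H q (s n) • star (entry q (y n)))

lemma rowDerivation_add (S : Finset ι) (r s x y : ι → Fin d) (H K : Matrix (Fin d) (Fin d) ℂ) :
    rowDerivation S r s x y (H + K) = rowDerivation S r s x y H + rowDerivation S r s x y K := by
  simp only [rowDerivation, rowMul, ← map_add, Matrix.add_apply, add_smul, Finset.sum_add_distrib,
    mul_add, add_mul]
  congr 1
  ring

/-- Complex homogeneity is why the conjugated factors carry `H q (s n)` rather than the conjugate of
`H (s n) q`. The two agree for self-adjoint H, and the former is linear in H, so vanishing extends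
from self-adjoint matrices to all matrices, matrix units included. -/
lemma rowDerivation_smul (S : Finset ι) (r s x y : ι → Fin d) (c : ℂ)
    (H : Matrix (Fin d) (Fin d) ℂ) :
    rowDerivation S r s x y (c • H) = c * rowDerivation S r s x y H := by
  refine Eq.trans (congrArg (mean (haarU d)) ?_) (map_smul (mean (haarU d)) c _)
  simp only [rowMul, Matrix.smul_apply, smul_eq_mul, mul_smul, ← Finset.smul_sum, mul_smul_comm,
    smul_mul_assoc, smul_sub]

-- The curve is exp(itH), the exponential of a skew-adjoint matrix.
open scoped Matrix.Norms.L2Operator in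
lemma exists_unitary_curve {H : Matrix (Fin d) (Fin d) ℂ} (hH : IsSelfAdjoint H) :
    ∃ W : ℝ → UGroup d, W 0 = 1 ∧ ∀ p q,
      HasDerivAt (fun t => (W t : Matrix (Fin d) (Fin d) ℂ) p q) (Complex.I * H p q) 0 := by
  have hs : ∀ t : ℝ, t • (Complex.I • H) ∈ skewAdjoint (Matrix (Fin d) (Fin d) ℂ) := by
    intro t
    rw [skewAdjoint.mem_iff]
    simp [star_smul, hH.star_eq]
  let _ : NormedAlgebra ℚ (Matrix (Fin d) (Fin d) ℂ) := NormedAlgebra.restrictScalars ℚ ℝ _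
  refine ⟨fun t => ⟨_, NormedSpace.exp_mem_unitary_of_mem_skewAdjoint (hs t)⟩, ?_, ?_⟩
  · ext; simp
  · intro p q
    have h := hasDerivAt_exp_smul_const (𝕂 := ℝ) (Complex.I • H) 0
    simp only [zero_smul, NormedSpace.exp_zero, one_mul] at h
    have h2 := ((Matrix.entryLinearMap ℝ ℂ p q).toContinuousLinearMap.hasFDerivAt).comp_hasDerivAt
      (0 : ℝ) h
    simpa [Function.comp_def] using h2

/-- By left invariance the moment of W(t)U does not depend on t; its derivative at t = 0 is i times
`rowDerivation`. -/
lemma rowDerivation_eq_zero_of_isSelfAdjoint (S : Finset ι) (r s x y : ι → Fin d)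
    {H : Matrix (Fin d) (Fin d) ℂ} (hH : IsSelfAdjoint H) : rowDerivation S r s x y H = 0 := by
  obtain ⟨W, hW0, hW⟩ := exists_unitary_curve hH
  have hrow : ∀ r x, HasDerivAt (fun t => rowMul (W t : Matrix (Fin d) (Fin d) ℂ) r x)
      (Complex.I • rowMul H r x) 0 := by
    intro r x
    have : HasDerivAt (fun t => rowMul (W t : Matrix (Fin d) (Fin d) ℂ) r x)
        (∑ q, (Complex.I * H r q) • entry q x) 0 :=
      HasDerivAt.fun_sum fun q _ => (hW r q).smul_const (entry q x)
    simpa [rowMul, Finset.smul_sum, mul_smul] using this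
  have hstar : ∀ s y, HasDerivAt (fun t => star (rowMul (W t : Matrix (Fin d) (Fin d) ℂ) s y))
      (-(Complex.I • ∑ q, H q s • star (entry q y))) 0 := by
    intro s y
    have hsq : ∀ q, star (H s q) = H q s := fun q => by
      simpa [Matrix.star_apply] using congrFun (congrFun hH.star_eq q) s
    have e : -(Complex.I • ∑ q, H q s • star (entry q y)) = star (Complex.I • rowMul H s y) := by
      simp only [rowMul, star_smul, star_sum, hsq, Complex.star_def, Complex.conj_I, neg_smul]
    rw [e]
    exact (hrow s y).star
  -- The product is differentiated in the Banach algebra C(U(d), ℂ). As `mean` is continuous and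
  -- linear there, nothing has to be differentiated under the integral sign.
  have hF := ((HasDerivAt.fun_finsetProd (u := S) fun m _ => hrow (r m) (x m)).mul
    (HasDerivAt.fun_finsetProd (u := S) fun m _ => hstar (s m) (y m)))
  have hG := (((mean (haarU d)).restrictScalars ℝ).hasFDerivAt).comp_hasDerivAt (0 : ℝ) hF
  have hconst : ((mean (haarU d)).restrictScalars ℝ) ∘
      ((fun t => ∏ m ∈ S, rowMul (W t : Matrix (Fin d) (Fin d) ℂ) (r m) (x m)) *
        fun t => ∏ m ∈ S, star (rowMul (W t : Matrix (Fin d) (Fin d) ℂ) (s m) (y m))) =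
      fun _ => mean (haarU d)
        ((∏ m ∈ S, entry (r m) (x m)) * ∏ m ∈ S, star (entry (s m) (y m))) := by
    funext t
    exact mean_haarU_rowMul S r s x y (W t)
  rw [hconst] at hG
  have h0 := hG.unique (hasDerivAt_const _ _)
  simp only [hW0, ContinuousLinearMap.coe_restrictScalars'] at h0
  have h1 : Complex.I * rowDerivation S r s x y H = 0 := by
    rw [← h0, rowDerivation, ← smul_eq_mul, ← map_smul]
    congr 1
    simp only [Submonoid.coe_one, rowMul_one, smul_eq_mul, mul_smul_comm, mul_neg,
      Finset.sum_neg_distrib, ← Finset.smul_sum, smul_mul_assoc, smul_sub]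
    ring
  simpa using h1

/-- Left invariance of the Haar measure in infinitesimal form. -/
theorem rowDerivation_eq_zero (S : Finset ι) (r s x y : ι → Fin d)
    (H : Matrix (Fin d) (Fin d) ℂ) : rowDerivation S r s x y H = 0 := by
  rw [← realPart_add_I_smul_imaginaryPart H, rowDerivation_add, rowDerivation_smul,
    rowDerivation_eq_zero_of_isSelfAdjoint _ _ _ _ _ (realPart H).2,
    rowDerivation_eq_zero_of_isSelfAdjoint _ _ _ _ _ (imaginaryPart H).2]
  simp

end Haar

/-! ### Combinations of permutations -/

section PermBounded

variable {d : ℕ} {ι : Type*} [Fintype ι] [DecidableEq ι]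

/-- The matrix `φ` is a linear combination of permutations of the tensor factors, with coefficients
of total size at most `K`. -/
def PermBounded (φ : (ι → Fin d) → (ι → Fin d) → ℂ) (K : ℝ) : Prop :=
  ∃ c : Equiv.Perm ι → ℂ, ∑ σ, ‖c σ‖ ≤ K ∧ ∀ x y, φ x y = ∑ σ : Equiv.Perm ι, if x = y ∘ σ then c σ else 0

lemma PermBounded.mono {φ : (ι → Fin d) → (ι → Fin d) → ℂ} {K L : ℝ} (h : PermBounded φ K)
    (hKL : K ≤ L) : PermBounded φ L := by
  obtain ⟨c, hc, h⟩ := h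
  exact ⟨c, hc.trans hKL, h⟩

lemma PermBounded.add {φ ψ : (ι → Fin d) → (ι → Fin d) → ℂ} {K L : ℝ} (h : PermBounded φ K)
    (h' : PermBounded ψ L) : PermBounded (fun x y => φ x y + ψ x y) (K + L) := by
  obtain ⟨c, hc, h⟩ := h
  obtain ⟨c', hc', h'⟩ := h'
  refine ⟨fun σ => c σ + c' σ, ?_, fun x y => ?_⟩
  · calc ∑ σ, ‖c σ + c' σ‖ ≤ ∑ σ, (‖c σ‖ + ‖c' σ‖) := Finset.sum_le_sum fun _ _ => norm_add_le _ _
      _ ≤ K + L := by rw [Finset.sum_add_distrib]; exact add_le_add hc hc'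
  · simp only [h, h']
    rw [← Finset.sum_add_distrib]
    refine Finset.sum_congr rfl fun σ _ => ?_
    split_ifs <;> simp

lemma PermBounded.const_mul {φ : (ι → Fin d) → (ι → Fin d) → ℂ} {K : ℝ} (h : PermBounded φ K)
    (z : ℂ) : PermBounded (fun x y => z * φ x y) (‖z‖ * K) := by
  obtain ⟨c, hc, h⟩ := h
  refine ⟨fun σ => z * c σ, ?_, fun x y => ?_⟩
  · simp only [norm_mul, ← Finset.mul_sum]
    exact mul_le_mul_of_nonneg_left hc (norm_nonneg _)
  · simp [h, Finset.mul_sum]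

lemma PermBounded.neg {φ : (ι → Fin d) → (ι → Fin d) → ℂ} {K : ℝ} (h : PermBounded φ K) :
    PermBounded (fun x y => -φ x y) K := by
  simpa using h.const_mul (-1)

lemma PermBounded.comp_perm {φ : (ι → Fin d) → (ι → Fin d) → ℂ} {K : ℝ} (h : PermBounded φ K)
    (τ : Equiv.Perm ι) : PermBounded (fun x y => φ x (y ∘ τ)) K := by
  obtain ⟨c, hc, h⟩ := h
  refine ⟨fun σ => c (τ⁻¹ * σ), ?_, fun x y => ?_⟩
  · rwa [Fintype.sum_equiv (Equiv.mulLeft τ⁻¹) (fun σ => ‖c (τ⁻¹ * σ)‖) (fun σ => ‖c σ‖)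
      (fun _ => rfl)]
  · simp only [h]
    refine Fintype.sum_equiv (Equiv.mulLeft τ) _ _ fun σ => ?_
    simp [Function.comp_assoc]

lemma PermBounded.sum {α : Type*} (s : Finset α) {φ : α → (ι → Fin d) → (ι → Fin d) → ℂ}
    {K : α → ℝ} (h : ∀ a ∈ s, PermBounded (φ a) (K a)) :
    PermBounded (fun x y => ∑ a ∈ s, φ a x y) (∑ a ∈ s, K a) := by
  classical
  induction s using Finset.induction_on with
  | empty => exact ⟨0, by simp, by simp⟩
  | insert a s ha ih =>
    simp only [Finset.sum_insert ha]
    exact (h a (Finset.mem_insert_self _ _)).add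
      (ih fun b hb => h b (Finset.mem_insert_of_mem hb))

lemma permBounded_one :
    PermBounded (fun x y : ι → Fin d => if x = y then (1 : ℂ) else 0) 1 := by
  refine ⟨Pi.single 1 1, ?_, fun x y => ?_⟩
  · rw [Finset.sum_eq_single 1] <;> simp +contextual
  · rw [Finset.sum_eq_single 1]
    · simp
    · intro σ _ hσ; simp [hσ]
    · simp

end PermBounded

/-! ### Moments of one row of a Haar unitary -/

section RowMoment

variable {d : ℕ} {ι : Type*} [Fintype ι] [DecidableEq ι]

lemma rowMul_single (i j p x : Fin d) :
    rowMul (Matrix.single i j 1) p x = if p = i then entry j x else 0 := by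
  by_cases h : p = i
  · subst h
    simp [rowMul, Matrix.single_apply]
  · simp [rowMul, h, Ne.symm h]

lemma sum_single_smul_star_entry (i j p y : Fin d) :
    ∑ q, (Matrix.single i j (1 : ℂ)) q p • star (entry q y) =
      if p = j then star (entry i y) else 0 := by
  by_cases h : p = j
  · subst h
    simp [Matrix.single_apply]
  · simp [h, Ne.symm h]

omit [Fintype ι] in
/-- Integration by parts for the moments of one row. -/
lemma mean_row_recursion (S : Finset ι) (a : Fin d) (x y : ι → Fin d) {i : ι} (hi : i ∈ S) :
    ((d : ℂ) + (S.card - 1 : ℕ)) *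
        mean (haarU d) ((∏ m ∈ S, entry a (x m)) * ∏ m ∈ S, star (entry a (y m))) =
      ∑ n ∈ S, if x i = y n then
        mean (haarU d) ((∏ m ∈ S.erase i, entry a (x m)) *
          ∏ m ∈ S.erase n, star (entry a (y m))) else 0 := by
  set P := ∏ m ∈ S, entry a (x m) with hP
  set Q := ∏ m ∈ S, star (entry a (y m)) with hQ
  set P' := ∏ m ∈ S.erase i, entry a (x m) with hP'
  have key : ∀ j : Fin d,
      mean (haarU d) ((P + if j = a then ((S.card - 1 : ℕ) : ℂ) • P else 0) * Q) =
        mean (haarU d) ((entry j (x i) * P') *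
          ∑ n ∈ S, (∏ m ∈ S.erase n, star (entry a (y m))) * star (entry j (y n))) := by
    intro j
    -- Row a is replaced by j at position i only, and the generator is the matrix unit E_{ja}. On
    -- the plain factors it restores row a at i, and for j = a it also reproduces P at each of the
    -- other positions. On the conjugated factors it turns row a into row j, one position n at a
    -- time.
    have h := rowDerivation_eq_zero S (Function.update (fun _ => a) i j) (fun _ => a) x y
      (Matrix.single j a 1)
    rw [rowDerivation, map_sub, sub_eq_zero] at h
    simp only [rowMul_single, sum_single_smul_star_entry, if_true] at h
    have h1 : ∑ n ∈ S, (∏ m ∈ S.erase n,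
        entry (Function.update (fun _ => a) i j m) (x m)) *
          (if Function.update (fun _ => a) i j n = j then entry a (x n) else 0) =
        P + if j = a then ((S.card - 1 : ℕ) : ℂ) • P else 0 := by
      rw [← Finset.add_sum_erase S _ hi]
      congr 1
      · rw [hP, ← Finset.prod_erase_mul S _ hi]
        simp only [Function.update_self, if_true]
        congr 1
        refine Finset.prod_congr rfl fun m hm => ?_
        rw [Function.update_of_ne (Finset.ne_of_mem_erase hm)]
      · by_cases hja : j = a
        · subst hja
          have hu : Function.update (fun _ : ι => j) i j = fun _ => j := by
            funext m; by_cases hm : m = i <;> simp [Function.update_apply]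
          simp only [hu, if_true]
          rw [Finset.sum_congr rfl fun n hn =>
            Finset.prod_erase_mul S (fun m => entry j (x m)) (Finset.mem_of_mem_erase hn)]
          rw [Finset.sum_const, Finset.card_erase_of_mem hi, Nat.cast_smul_eq_nsmul]
        · rw [if_neg hja]
          refine Finset.sum_eq_zero fun n hn => ?_
          rw [Function.update_of_ne (Finset.ne_of_mem_erase hn), if_neg (Ne.symm hja), mul_zero]
    have h2 : ∏ m ∈ S, entry (Function.update (fun _ => a) i j m) (x m) = entry j (x i) * P' := by
      rw [← Finset.mul_prod_erase S _ hi]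
      simp only [Function.update_self]
      congr 1
      refine Finset.prod_congr rfl fun m hm => ?_
      rw [Function.update_of_ne (Finset.ne_of_mem_erase hm)]
    rw [h1, h2] at h
    exact h
  -- Summed over j, the left side collects the factor d + |S| - 1, and orthonormality of columns
  -- contracts positions i and n on the right.
  have hsum := Finset.sum_congr (rfl : (Finset.univ : Finset (Fin d)) = Finset.univ)
    fun j _ => key j
  rw [← map_sum, ← map_sum, ← Finset.sum_mul] at hsum
  have hl : ∑ j : Fin d, (P + if j = a then ((S.card - 1 : ℕ) : ℂ) • P else 0) =
      ((d : ℂ) + (S.card - 1 : ℕ)) • P := by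
    rw [Finset.sum_add_distrib, Finset.sum_ite_eq' Finset.univ a, add_smul]
    simp [Nat.cast_smul_eq_nsmul]
  have hr : ∑ j : Fin d, (entry j (x i) * P') *
      ∑ n ∈ S, (∏ m ∈ S.erase n, star (entry a (y m))) * star (entry j (y n)) =
      ∑ n ∈ S, if x i = y n then P' * ∏ m ∈ S.erase n, star (entry a (y m)) else 0 := by
    simp only [Finset.mul_sum]
    rw [Finset.sum_comm]
    refine Finset.sum_congr rfl fun n _ => ?_
    trans (∑ j, entry j (x i) * star (entry j (y n))) *
      (P' * ∏ m ∈ S.erase n, star (entry a (y m)))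
    · rw [Finset.sum_mul]
      refine Finset.sum_congr rfl fun j _ => ?_
      ring
    · rw [sum_entry_mul_star]
      split_ifs <;> simp
  rw [hl, hr, smul_mul_assoc, map_smul, map_sum, smul_eq_mul] at hsum
  rw [hsum]
  refine Finset.sum_congr rfl fun n _ => ?_
  split_ifs <;> simp

/-- The moment of the row `a` on the tensor factors in `S`, and the identity on the others. -/
def rowMoment (μ : Measure (UGroup d)) [IsFiniteMeasure μ] (S : Finset ι) (a : Fin d)
    (x y : ι → Fin d) : ℂ :=
  if ∀ n ∉ S, x n = y n then
    mean μ ((∏ m ∈ S, entry a (x m)) * ∏ m ∈ S, star (entry a (y m))) else 0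

/-- The contraction of x i with y n is the identity on copy i after the transposition of i and n.
The recursion thus becomes one between operators on all copies, of the form that `PermBounded`
handles. -/
lemma rowMoment_recursion (hd : 0 < d) (S : Finset ι) (a : Fin d) {i : ι} (hi : i ∈ S)
    (x y : ι → Fin d) :
    rowMoment (haarU d) S a x y =
      ((d : ℂ) + (S.card - 1 : ℕ))⁻¹ *
        ∑ n ∈ S, rowMoment (haarU d) (S.erase i) a x (y ∘ Equiv.swap i n) := by
  have hne : ((d : ℂ) + (S.card - 1 : ℕ)) ≠ 0 := by
    rw [← Nat.cast_add]; exact_mod_cast (by omega : d + (S.card - 1) ≠ 0)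
  have hfix : ∀ n ∈ S, ∀ m ∉ S, Equiv.swap i n m = m := fun n hn m hm =>
    Equiv.swap_apply_of_ne_of_ne (fun h => hm (h ▸ hi)) (fun h => hm (h ▸ hn))
  by_cases hxy : ∀ n ∉ S, x n = y n
  · rw [eq_inv_mul_iff_mul_eq₀ hne, rowMoment, if_pos hxy, mean_row_recursion S a x y hi]
    refine Finset.sum_congr rfl fun n hn => ?_
    have hiff : (∀ m ∉ S.erase i, x m = (y ∘ Equiv.swap i n) m) ↔ x i = y n := by
      constructor
      · intro h; simpa using h i (Finset.notMem_erase _ _)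
      · intro h m hm
        by_cases hmi : m = i
        · subst hmi; simpa using h
        · have hmS : m ∉ S := fun h => hm (Finset.mem_erase.2 ⟨hmi, h⟩)
          rw [Function.comp_apply, hfix n hn m hmS, hxy m hmS]
    rw [rowMoment]
    simp only [hiff]
    split_ifs
    · congr 2
      refine Finset.prod_equiv (Equiv.swap i n) (fun m => ?_) (fun m _ => by simp)
      by_cases hmi : m = i
      · subst hmi
        by_cases hmn : m = n
        · subst hmn; simp
        · simp [Ne.symm hmn, hmn, hn, hi]
      · by_cases hmn : m = n
        · subst hmn; simp
        · simp [Equiv.swap_apply_of_ne_of_ne hmi hmn, hmi, hmn]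
    · rfl
  · rw [rowMoment, if_neg hxy, Finset.sum_eq_zero, mul_zero]
    intro n hn
    push Not at hxy
    obtain ⟨m, hm, hxm⟩ := hxy
    rw [rowMoment, if_neg]
    intro h
    refine hxm ?_
    simpa [hfix n hn m hm] using h m (fun h => hm (Finset.mem_of_mem_erase h))

/-- A moment of order `t` of a row of a Haar unitary is `O(d⁻ᵗ)`. -/
theorem permBounded_rowMoment (hd : 0 < d) (S : Finset ι) (a : Fin d) :
    PermBounded (rowMoment (haarU d) S a) (S.card.factorial / (d : ℝ) ^ S.card) := by
  induction hS : S.card generalizing S with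
  | zero =>
    rw [Finset.card_eq_zero] at hS
    subst hS
    have : rowMoment (haarU d) ∅ a = fun x y : ι → Fin d => if x = y then (1 : ℂ) else 0 := by
      funext x y
      simp [rowMoment, mean_one, funext_iff]
    rw [this]
    simpa using permBounded_one
  | succ t ih =>
    obtain ⟨i, hi⟩ : S.Nonempty := Finset.card_pos.1 (by omega)
    have hrec : rowMoment (haarU d) S a = fun x y => ((d : ℂ) + (S.card - 1 : ℕ))⁻¹ *
        ∑ n ∈ S, rowMoment (haarU d) (S.erase i) a x (y ∘ Equiv.swap i n) := by
      funext x y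
      exact rowMoment_recursion hd S a hi x y
    rw [hrec]
    have h := ih (S.erase i) (by rw [Finset.card_erase_of_mem hi]; omega)
    -- One recursion step produces t + 1 permuted terms, each of weight 1/(d + t) ≤ 1/d.
    refine ((PermBounded.sum S fun n _ => h.comp_perm (Equiv.swap i n)).const_mul _).mono ?_
    have hd' : (0 : ℝ) < d := by exact_mod_cast hd
    have hn : ‖((d : ℂ) + (S.card - 1 : ℕ))⁻¹‖ ≤ (d : ℝ)⁻¹ := by
      rw [norm_inv, ← Nat.cast_add, Complex.norm_natCast]
      refine inv_anti₀ hd' ?_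
      push_cast
      linarith [(Nat.cast_nonneg (S.card - 1) : (0 : ℝ) ≤ _)]
    rw [hS] at hn ⊢
    rw [Finset.sum_const, hS, nsmul_eq_mul, Nat.factorial_succ, pow_succ]
    refine (mul_le_mul_of_nonneg_right hn (by positivity)).trans (le_of_eq ?_)
    push_cast
    field_simp

end RowMoment

/-! ### Moments of two rows of a Haar unitary -/

section TwoRows

variable {d : ℕ}

/-- Infinitesimal invariance under E_{cb}, applied to the plain rows a, a, c, b and the conjugated
rows a, a, b, b. Row c becomes b on the plain side, either b becomes c on the conjugated side, and
row a is untouched. -/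
lemma mean_two_rows {a b c : Fin d} (hca : c ≠ a) (hba : b ≠ a) (hcb : c ≠ b)
    (x₀ x₁ x₂ x₃ y₀ y₁ y₂ y₃ : Fin d) :
    mean (haarU d) (entry a x₀ * entry a x₁ * star (entry a y₀) * star (entry a y₁) *
        (entry b x₂ * star (entry b y₂) * (entry b x₃ * star (entry b y₃)))) =
      mean (haarU d) (entry a x₀ * entry a x₁ * star (entry a y₀) * star (entry a y₁) *
        (entry c x₂ * star (entry c y₂) * (entry b x₃ * star (entry b y₃)) +
          entry c x₂ * star (entry c y₃) * (entry b x₃ * star (entry b y₂)))) := by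
  have h := rowDerivation_eq_zero Finset.univ ![a, a, c, b] ![a, a, b, b] ![x₀, x₁, x₂, x₃]
    ![y₀, y₁, y₂, y₃] (Matrix.single c b 1)
  have e0 : (Finset.univ : Finset (Fin 4)).erase 0 = {1, 2, 3} := by decide
  have e1 : (Finset.univ : Finset (Fin 4)).erase 1 = {0, 2, 3} := by decide
  have e2 : (Finset.univ : Finset (Fin 4)).erase 2 = {0, 1, 3} := by decide
  have e3 : (Finset.univ : Finset (Fin 4)).erase 3 = {0, 1, 2} := by decide
  rw [rowDerivation, map_sub, sub_eq_zero] at h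
  simp only [rowMul_single, sum_single_smul_star_entry, Fin.sum_univ_four, Fin.prod_univ_four,
    e0, e1, e2, e3] at h
  simp [hca.symm, hba.symm, hcb.symm] at h
  convert h using 2 <;> ring

/-- The projection onto the orthogonal complement of the row `a`. -/
def rowCompl (a x y : Fin d) : C(UGroup d, ℂ) :=
  (if x = y then 1 else 0) - entry a x * star (entry a y)

lemma sum_erase_entry (a x y : Fin d) :
    ∑ c ∈ Finset.univ.erase a, entry c x * star (entry c y) = rowCompl a x y := by
  rw [rowCompl, ← sum_entry_mul_star, Finset.sum_erase_eq_sub (Finset.mem_univ a)]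

/-- Expand the complements as sums over rows b, c ≠ a. For fixed b, the d - 2 rows c ∉ {a, b} give
the two-row moment once each by `mean_two_rows`, and c = b gives it twice, hence the factor d. The
right side involves row a alone, so the one-row bounds apply and d is the only divisor. -/
lemma sum_mean_two_rows (a x₀ x₁ x₂ x₃ y₀ y₁ y₂ y₃ : Fin d) :
    (d : ℂ) * ∑ b ∈ Finset.univ.erase a,
      mean (haarU d) (entry a x₀ * entry a x₁ * star (entry a y₀) * star (entry a y₁) *
        (entry b x₂ * star (entry b y₂) * (entry b x₃ * star (entry b y₃)))) =
      mean (haarU d) (entry a x₀ * entry a x₁ * star (entry a y₀) * star (entry a y₁) *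
        (rowCompl a x₂ y₂ * rowCompl a x₃ y₃)) +
      mean (haarU d) (entry a x₀ * entry a x₁ * star (entry a y₀) * star (entry a y₁) *
        (rowCompl a x₂ y₃ * rowCompl a x₃ y₂)) := by
  set G := entry a x₀ * entry a x₁ * star (entry a y₀) * star (entry a y₁)
  rw [← map_add, ← mul_add]
  simp only [← sum_erase_entry, Finset.sum_mul_sum, ← Finset.sum_add_distrib]
  rw [Finset.sum_comm]
  simp only [Finset.mul_sum, map_sum]
  refine Finset.sum_congr rfl fun b hb => ?_
  have hba := Finset.ne_of_mem_erase hb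
  rw [← Finset.add_sum_erase _ _ hb]
  rw [Finset.sum_congr rfl fun c hc => (mean_two_rows (Finset.ne_of_mem_erase
    (Finset.mem_of_mem_erase hc)) hba (Finset.ne_of_mem_erase hc) x₀ x₁ x₂ x₃ y₀ y₁ y₂ y₃).symm]
  have hcard : ((Finset.univ.erase a).erase b).card + 2 = d := by
    have h1 := Finset.card_erase_add_one hb
    have h2 := Finset.card_erase_add_one (Finset.mem_univ a)
    rw [Finset.card_univ, Fintype.card_fin] at h2
    omega
  have hd : (d : ℂ) = (((Finset.univ.erase a).erase b).card : ℂ) + 2 := by exact_mod_cast hcard.symm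
  rw [Finset.sum_const, nsmul_eq_mul, hd, mul_add, map_add, add_mul]
  have : entry b x₂ * star (entry b y₃) * (entry b x₃ * star (entry b y₂)) =
    entry b x₂ * star (entry b y₂) * (entry b x₃ * star (entry b y₃)) := by ring
  rw [this]
  ring

end TwoRows

/-! ### Diagonal observables -/

section Weighted

variable {d : ℕ} {ι : Type*} [Fintype ι] [DecidableEq ι]

/-- The average of `(U†)^{⊗ ι} f U^{⊗ ι}`, for a diagonal observable `f`. -/
def diagTwirl (μ : Measure (UGroup d)) [IsFiniteMeasure μ] (f : (ι → Fin d) → ℝ)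
    (x y : ι → Fin d) : ℂ :=
  mean μ (∑ a : ι → Fin d, (f a : ℂ) • ∏ n, (entry (a n) (x n) * star (entry (a n) (y n))))

section

variable (μ : Measure (UGroup d)) [IsFiniteMeasure μ]

lemma diagTwirl_add (f g : (ι → Fin d) → ℝ) (x y : ι → Fin d) :
    diagTwirl μ (fun a => f a + g a) x y = diagTwirl μ f x y + diagTwirl μ g x y := by
  simp [diagTwirl, ← Finset.sum_add_distrib, add_mul]

lemma diagTwirl_const_mul (c : ℝ) (f : (ι → Fin d) → ℝ) (x y : ι → Fin d) :
    diagTwirl μ (fun a => c * f a) x y = c * diagTwirl μ f x y := by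
  rw [diagTwirl, diagTwirl, ← smul_eq_mul, ← map_smul, Finset.smul_sum]
  simp [mul_smul]

lemma diagTwirl_sum {α : Type*} (s : Finset α) (f : α → (ι → Fin d) → ℝ) (x y : ι → Fin d) :
    diagTwirl μ (fun a => ∑ i ∈ s, f i a) x y = ∑ i ∈ s, diagTwirl μ (f i) x y := by
  simp only [diagTwirl, ← map_sum]
  rw [Finset.sum_comm]
  simp [Finset.sum_smul]

/-- The indicator of the outcomes which agree with `r` on `S`. -/
def fixedRows (S : Finset ι) (r a : ι → Fin d) : ℝ := if ∀ n ∈ S, a n = r n then 1 else 0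

/-- Labels outside S are summed freely, and orthonormality of columns leaves the identity there.
Only a moment of order |S| remains, however many copies there are. -/
lemma diagTwirl_fixedRows (S : Finset ι) (r x y : ι → Fin d) :
    diagTwirl μ (fixedRows S r) x y = if ∀ n ∉ S, x n = y n then
      mean μ (∏ n ∈ S, (entry (r n) (x n) * star (entry (r n) (y n)))) else 0 := by
  have h1 : ∀ a : ι → Fin d, ((fixedRows S r a : ℝ) : ℂ) •
      ∏ n, (entry (a n) (x n) * star (entry (a n) (y n))) =
      ∏ n, (if n ∈ S → a n = r n then entry (a n) (x n) * star (entry (a n) (y n)) else 0) := by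
    intro a
    rw [Finset.prod_ite_zero, fixedRows]
    by_cases h : ∀ n ∈ S, a n = r n
    · rw [if_pos h, if_pos (by simpa using h)]; simp
    · rw [if_neg h, if_neg (by simpa using h)]; simp
  have h2 : ∀ n, ∑ q : Fin d, (if n ∈ S → q = r n then entry q (x n) * star (entry q (y n)) else 0)
      = if n ∈ S then entry (r n) (x n) * star (entry (r n) (y n)) else
        if x n = y n then 1 else 0 := by
    intro n
    by_cases hn : n ∈ S
    · simp [hn]
    · simp [hn, sum_entry_mul_star]
  rw [diagTwirl, Finset.sum_congr rfl fun a _ => h1 a]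
  rw [← Fintype.piFinset_univ, Finset.sum_prod_piFinset Finset.univ
    (fun n q => if n ∈ S → q = r n then entry q (x n) * star (entry q (y n)) else 0)]
  simp only [h2]
  rw [Finset.prod_ite, Finset.prod_ite_zero, Finset.filter_mem_eq_inter, Finset.univ_inter]
  simp only [Finset.mem_filter, Finset.mem_univ, true_and, Finset.prod_const_one]
  split_ifs <;> simp

lemma diagTwirl_fixedRows_const (S : Finset ι) (c : Fin d) (x y : ι → Fin d) :
    diagTwirl μ (fixedRows S fun _ => c) x y = rowMoment μ S c x y := by
  rw [diagTwirl_fixedRows, rowMoment]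
  simp only [Finset.prod_mul_distrib]

end

/-! ### Unitary designs -/

/-- Diagonal entries of twirled matrix units are the only information about a design that is needed.
-/
lemma twirl_single (μ : Measure (UGroup d)) [IsFiniteMeasure μ] {t : ℕ} (r x y : Fin t → Fin d) :
    twirl μ t (Matrix.single x y 1) r r =
      mean μ (∏ n, (entry (r n) (x n) * star (entry (r n) (y n)))) := by
  rw [twirl, Matrix.of_apply, mean_apply]
  refine integral_congr_ae (Filter.Eventually.of_forall fun U => ?_)
  simp [Matrix.mul_apply, Matrix.single_apply, tensorPow, ContinuousMap.prod_apply,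
    Finset.prod_mul_distrib, ite_and]

/-- An extra factor |U_{c0}|² sums to 1 over c, so moments of order t + 1 determine those of order
t. -/
lemma mean_eq_of_succ (hd : 0 < d) (μ ν : Measure (UGroup d)) [IsFiniteMeasure μ]
    [IsFiniteMeasure ν] {t : ℕ}
    (h : ∀ r x y : Fin (t + 1) → Fin d,
      mean μ (∏ n, (entry (r n) (x n) * star (entry (r n) (y n)))) =
        mean ν (∏ n, (entry (r n) (x n) * star (entry (r n) (y n)))))
    (r x y : Fin t → Fin d) :
    mean μ (∏ n, (entry (r n) (x n) * star (entry (r n) (y n)))) =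
      mean ν (∏ n, (entry (r n) (x n) * star (entry (r n) (y n)))) := by
  have hs : ∀ c : Fin d, _ := fun c =>
    h (Fin.cons c r) (Fin.cons ⟨0, hd⟩ x) (Fin.cons ⟨0, hd⟩ y)
  simp only [Fin.prod_univ_succ, Fin.cons_zero, Fin.cons_succ] at hs
  have hs' := Finset.sum_congr (rfl : (Finset.univ : Finset (Fin d)) = Finset.univ)
    fun c _ => hs c
  rw [← map_sum, ← map_sum, ← Finset.sum_mul, sum_entry_mul_star] at hs'
  simpa using hs'

lemma IsUnitaryDesign.mean_eq {μ : Measure (UGroup d)} [IsFiniteMeasure μ] {T : ℕ}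
    (hμ : IsUnitaryDesign T μ) (hd : 0 < d) {t : ℕ} (ht : t ≤ T) :
    ∀ r x y : Fin t → Fin d,
      mean μ (∏ n, (entry (r n) (x n) * star (entry (r n) (y n)))) =
        mean (haarU d) (∏ n, (entry (r n) (x n) * star (entry (r n) (y n)))) := by
  induction ht using Nat.decreasingInduction with
  | self =>
    intro r x y
    rw [← twirl_single, ← twirl_single, hμ.twirl_eq]
  | of_succ k hk ih => exact mean_eq_of_succ hd _ _ ih

omit [Fintype ι] [DecidableEq ι] in
lemma IsUnitaryDesign.mean_finset_eq {μ : Measure (UGroup d)} [IsFiniteMeasure μ] {T : ℕ}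
    (hμ : IsUnitaryDesign T μ) (hd : 0 < d) (S : Finset ι) (hS : S.card ≤ T)
    (r x y : ι → Fin d) :
    mean μ (∏ n ∈ S, (entry (r n) (x n) * star (entry (r n) (y n)))) =
      mean (haarU d) (∏ n ∈ S, (entry (r n) (x n) * star (entry (r n) (y n)))) := by
  have key : ∏ n ∈ S, (entry (r n) (x n) * star (entry (r n) (y n))) =
      ∏ m : Fin S.card, (entry (r (S.equivFin.symm m)) (x (S.equivFin.symm m)) *
        star (entry (r (S.equivFin.symm m)) (y (S.equivFin.symm m)))) := by
    rw [← Finset.prod_coe_sort]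
    exact (Equiv.prod_comp S.equivFin.symm _).symm
  rw [key]
  exact hμ.mean_eq hd hS (fun m => r (S.equivFin.symm m)) (fun m => x (S.equivFin.symm m))
    (fun m => y (S.equivFin.symm m))

lemma IsUnitaryDesign.diagTwirl_fixedRows_eq {μ : Measure (UGroup d)} [IsFiniteMeasure μ] {T : ℕ}
    (hμ : IsUnitaryDesign T μ) (hd : 0 < d) (S : Finset ι) (hS : S.card ≤ T)
    (r x y : ι → Fin d) :
    diagTwirl μ (fixedRows S r) x y = diagTwirl (haarU d) (fixedRows S r) x y := by
  rw [diagTwirl_fixedRows, diagTwirl_fixedRows, hμ.mean_finset_eq hd S hS]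

end Weighted

/-! ### Bounds for the kernels -/

section LetterBound

variable {d : ℕ} {ι : Type*} [Fintype ι] [DecidableEq ι]

/-- Inclusion-exclusion: expand the product of the two projections 1 - |a⟩⟨a| acting on copies k and
l. -/
lemma rowMoment_alternating_sum (a : Fin d) {i j k l : ι} (hij : i ≠ j) (hik : i ≠ k) (hil : i ≠ l)
    (hjk : j ≠ k) (hjl : j ≠ l) (hkl : k ≠ l) (x y : ι → Fin d) :
    rowMoment (haarU d) {i, j} a x y - rowMoment (haarU d) {i, j, k} a x y -
        rowMoment (haarU d) {i, j, l} a x y + rowMoment (haarU d) {i, j, k, l} a x y =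
      if ∀ n ∉ ({i, j, k, l} : Finset ι), x n = y n then
        mean (haarU d) (entry a (x i) * entry a (x j) * star (entry a (y i)) *
          star (entry a (y j)) * (rowCompl a (x k) (y k) * rowCompl a (x l) (y l))) else 0 := by
  have hs : ∀ P : ι → Prop, ((∀ n ∉ ({i, j} : Finset ι), P n) ↔
      (∀ n ∉ ({i, j, k, l} : Finset ι), P n) ∧ P k ∧ P l) ∧
      ((∀ n ∉ ({i, j, k} : Finset ι), P n) ↔ (∀ n ∉ ({i, j, k, l} : Finset ι), P n) ∧ P l) ∧
      ((∀ n ∉ ({i, j, l} : Finset ι), P n) ↔ (∀ n ∉ ({i, j, k, l} : Finset ι), P n) ∧ P k) := by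
    intro P
    simp only [Finset.mem_insert, Finset.mem_singleton, not_or]
    refine ⟨⟨fun h => ⟨fun n hn => h n ⟨hn.1, hn.2.1⟩, h k ⟨hik.symm, hjk.symm⟩,
      h l ⟨hil.symm, hjl.symm⟩⟩, fun h n hn => ?_⟩,
      ⟨fun h => ⟨fun n hn => h n ⟨hn.1, hn.2.1, hn.2.2.1⟩,
      h l ⟨hil.symm, hjl.symm, hkl.symm⟩⟩, fun h n hn => ?_⟩,
      ⟨fun h => ⟨fun n hn => h n ⟨hn.1, hn.2.1, hn.2.2.2⟩, h k ⟨hik.symm, hjk.symm, hkl⟩⟩,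
        fun h n hn => ?_⟩⟩
    · by_cases hk : n = k
      · exact hk ▸ h.2.1
      · by_cases hl : n = l
        · exact hl ▸ h.2.2
        · exact h.1 n ⟨hn.1, hn.2, hk, hl⟩
    · by_cases hl : n = l
      · exact hl ▸ h.2
      · exact h.1 n ⟨hn.1, hn.2.1, hn.2.2, hl⟩
    · by_cases hk : n = k
      · exact hk ▸ h.2
      · exact h.1 n ⟨hn.1, hn.2.1, hk, hn.2.2⟩
  obtain ⟨h2, hk3, hl3⟩ := hs fun n => x n = y n
  simp only [rowMoment, h2, hk3, hl3, rowCompl]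
  by_cases hP : ∀ n ∉ ({i, j, k, l} : Finset ι), x n = y n
  · simp only [eq_true hP, true_and, if_true]
    rcases Classical.propComplete (x k = y k) with hxk | hxk <;>
      rcases Classical.propComplete (x l = y l) with hxl | hxl <;>
      simp only [hxk, hxl, and_self, and_true, and_false, if_true, if_false, sub_zero,
        zero_sub, zero_add, ← map_sub, ← map_add, ← map_neg] <;> congr 1 <;>
      simp [Finset.prod_insert, hij, hik, hil, hjk, hjl, hkl] <;> ring
  · simp only [eq_false hP, false_and, if_false]
    simp

/-- The labels which are `a` on `i, j` and `b` elsewhere. -/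
def rowPair (i j : ι) (a b : Fin d) (n : ι) : Fin d := if n = i ∨ n = j then a else b

/-- The term b = a is a one-row moment of order four. The terms b ≠ a are summed together by
`sum_mean_two_rows`; its two products of complements differ by exchanging copies k and l, and each
is an alternating sum of one-row moments. -/
lemma diagTwirl_rowPair_sum (hd : 0 < d) (a : Fin d) {i j k l : ι} (hij : i ≠ j) (hik : i ≠ k)
    (hil : i ≠ l) (hjk : j ≠ k) (hjl : j ≠ l) (hkl : k ≠ l) :
    PermBounded (fun x y => ∑ b, diagTwirl (haarU d) (fixedRows {i, j, k, l} (rowPair i j a b)) x y)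
      (100 / (d : ℝ) ^ 3) := by
  have hd1 : (1 : ℝ) ≤ d := by exact_mod_cast hd
  have hd0 : (d : ℂ) ≠ 0 := by exact_mod_cast hd.ne'
  have c2 : ({i, j} : Finset ι).card = 2 := Finset.card_pair hij
  have c3 : ({i, j, k} : Finset ι).card = 3 := by
    rw [Finset.card_insert_of_notMem (by simp [hij, hik]), Finset.card_pair hjk]
  have c3' : ({i, j, l} : Finset ι).card = 3 := by
    rw [Finset.card_insert_of_notMem (by simp [hij, hil]), Finset.card_pair hjl]
  have c4 : ({i, j, k, l} : Finset ι).card = 4 := by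
    rw [Finset.card_insert_of_notMem (by simp [hij, hik, hil]),
      Finset.card_insert_of_notMem (by simp [hjk, hjl]), Finset.card_pair hkl]
  have b2 := permBounded_rowMoment hd {i, j} a
  have b3 := permBounded_rowMoment hd {i, j, k} a
  have b3' := permBounded_rowMoment hd {i, j, l} a
  have b4 := permBounded_rowMoment hd {i, j, k, l} a
  rw [c2] at b2; rw [c3] at b3; rw [c3'] at b3'; rw [c4] at b4
  have alt := ((b2.add b3.neg).add b3'.neg).add b4
  have hsplit : (fun x y => ∑ b,
      diagTwirl (haarU d) (fixedRows {i, j, k, l} (rowPair i j a b)) x y) = fun x y =>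
      rowMoment (haarU d) {i, j, k, l} a x y + (d : ℂ)⁻¹ *
        ((rowMoment (haarU d) {i, j} a x y + -rowMoment (haarU d) {i, j, k} a x y +
        -rowMoment (haarU d) {i, j, l} a x y + rowMoment (haarU d) {i, j, k, l} a x y) +
        (rowMoment (haarU d) {i, j} a x (y ∘ Equiv.swap k l) +
          -rowMoment (haarU d) {i, j, k} a x (y ∘ Equiv.swap k l) +
        -rowMoment (haarU d) {i, j, l} a x (y ∘ Equiv.swap k l) +
          rowMoment (haarU d) {i, j, k, l} a x (y ∘ Equiv.swap k l))) := by
    funext x y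
    have hself : rowPair i j a a = fun _ : ι => a := by funext n; simp [rowPair]
    rw [← Finset.add_sum_erase _ _ (Finset.mem_univ a), hself, diagTwirl_fixedRows_const]
    congr 1
    rw [eq_inv_mul_iff_mul_eq₀ hd0]
    simp only [← sub_eq_add_neg]
    rw [rowMoment_alternating_sum a hij hik hil hjk hjl hkl,
      rowMoment_alternating_sum a hij hik hil hjk hjl hkl]
    have hsw : (∀ n ∉ ({i, j, k, l} : Finset ι), x n = (y ∘ Equiv.swap k l) n) ↔
        ∀ n ∉ ({i, j, k, l} : Finset ι), x n = y n := by
      refine forall₂_congr fun n hn => ?_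
      simp only [Finset.mem_insert, Finset.mem_singleton, not_or] at hn
      rw [Function.comp_apply, Equiv.swap_apply_of_ne_of_ne hn.2.2.1 hn.2.2.2]
    simp only [hsw, diagTwirl_fixedRows]
    by_cases hP : ∀ n ∉ ({i, j, k, l} : Finset ι), x n = y n
    · rw [if_pos hP, if_pos hP]
      simp only [if_pos hP, Function.comp_apply, Equiv.swap_apply_left, Equiv.swap_apply_right,
        Equiv.swap_apply_of_ne_of_ne hik hil, Equiv.swap_apply_of_ne_of_ne hjk hjl]
      rw [← sum_mean_two_rows]
      congr 1
      refine Finset.sum_congr rfl fun b _ => congrArg _ ?_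
      rw [Finset.prod_insert (by simp [hij, hik, hil]), Finset.prod_insert (by simp [hjk, hjl]),
        Finset.prod_pair hkl]
      simp only [rowPair, true_or, or_true, if_true, hik.symm, hjk.symm, hil.symm, hjl.symm, or_self,
        if_false]
      ring
    · simp only [eq_false hP, if_false]
      simp
  rw [hsplit]
  -- The constant is 24 + 2·38: the fourth moment gives 24/d⁴, and each alternating sum costs 2/d² +
  -- 6/d³ + 6/d³ + 24/d⁴ ≤ 38/d².
  refine (b4.add ((alt.add (alt.comp_perm (Equiv.swap k l))).const_mul _)).mono ?_
  rw [norm_inv, Complex.norm_natCast]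
  have hpos : (0 : ℝ) < d := by linarith
  rw [le_div_iff₀ (by positivity)]
  norm_num [Nat.factorial]
  field_simp
  nlinarith

lemma fixedRows_pair_sum (i j : ι) (a : ι → Fin d) :
    ∑ c, fixedRows {i, j} (fun _ => c) a = if a i = a j then 1 else 0 := by
  simp only [fixedRows, Finset.mem_insert, Finset.mem_singleton, forall_eq_or_imp, forall_eq]
  by_cases h : a i = a j
  · simp [h]
  · rw [if_neg h]
    exact Finset.sum_eq_zero fun c _ => if_neg fun hc => h (hc.1.trans hc.2.symm)

/-- The indicator of `a i = a j`. -/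
def eqInd (i j : ι) (a : ι → Fin d) : ℝ := if a i = a j then 1 else 0

omit [Fintype ι] [DecidableEq ι] in
lemma eqInd_comm (i j : ι) : (eqInd i j : (ι → Fin d) → ℝ) = eqInd j i := by
  funext a; simp [eqInd, eq_comm]

variable {μ : Measure (UGroup d)} [IsFiniteMeasure μ]

lemma permBounded_sum_fixedRows_const (hμ : IsUnitaryDesign 4 μ) (hd : 0 < d) (S : Finset ι)
    (hS : S.card ≤ 4) :
    PermBounded (diagTwirl μ fun a => ∑ c, fixedRows S (fun _ => c) a)
      (d * (S.card.factorial / (d : ℝ) ^ S.card)) := by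
  have : diagTwirl μ (fun a => ∑ c, fixedRows S (fun _ => c) a) =
      fun x y : ι → Fin d => ∑ c : Fin d, rowMoment (haarU d) S c x y := by
    funext x y
    rw [diagTwirl_sum]
    refine Finset.sum_congr rfl fun c _ => ?_
    rw [hμ.diagTwirl_fixedRows_eq hd S hS, diagTwirl_fixedRows_const]
  rw [this]
  exact (PermBounded.sum Finset.univ fun c _ => permBounded_rowMoment hd S c).mono (by simp)

lemma permBounded_eqInd (hμ : IsUnitaryDesign 4 μ) (hd : 0 < d) {i j : ι} (hij : i ≠ j) :
    PermBounded (diagTwirl μ (eqInd i j)) (2 / d) := by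
  have h := permBounded_sum_fixedRows_const hμ hd {i, j} (by rw [Finset.card_pair hij]; norm_num)
  simp only [fixedRows_pair_sum, Finset.card_pair hij] at h
  refine h.mono (le_of_eq ?_)
  have : (0 : ℝ) < d := by exact_mod_cast hd
  norm_num [Nat.factorial]
  field_simp

lemma permBounded_eqInd_mul_of_shared (hμ : IsUnitaryDesign 4 μ) (hd : 0 < d) {i j k : ι}
    (hij : i ≠ j) (hik : i ≠ k) (hjk : j ≠ k) :
    PermBounded (diagTwirl μ fun a => eqInd i j a * eqInd i k a) (100 / (d : ℝ) ^ 2) := by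
  have c3 : ({i, j, k} : Finset ι).card = 3 := by
    rw [Finset.card_insert_of_notMem (by simp [hij, hik]), Finset.card_pair hjk]
  have h := permBounded_sum_fixedRows_const hμ hd {i, j, k} (by rw [c3]; norm_num)
  have e : (fun a : ι → Fin d => ∑ c, fixedRows {i, j, k} (fun _ => c) a) =
      fun a => eqInd i j a * eqInd i k a := by
    funext a
    simp only [fixedRows, eqInd, Finset.mem_insert, Finset.mem_singleton, forall_eq_or_imp,
      forall_eq]
    by_cases h1 : a i = a j
    · by_cases h2 : a i = a k
      · simp [← h1, ← h2]
      · rw [if_neg h2, mul_zero]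
        exact Finset.sum_eq_zero fun c _ => if_neg fun hc => h2 (hc.1.trans hc.2.2.symm)
    · rw [if_neg h1, zero_mul]
      exact Finset.sum_eq_zero fun c _ => if_neg fun hc => h1 (hc.1.trans hc.2.1.symm)
  rw [e, c3] at h
  refine h.mono ?_
  have : (0 : ℝ) < d := by exact_mod_cast hd
  rw [le_div_iff₀ (by positivity)]
  norm_num [Nat.factorial]
  field_simp
  norm_num

/-- Both common values b and c are free. For fixed b the sum over c is O(d⁻³), and summing over b
loses a factor d. -/
lemma permBounded_eqInd_mul_of_disjoint (hμ : IsUnitaryDesign 4 μ) (hd : 0 < d) {i j k l : ι}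
    (hij : i ≠ j) (hik : i ≠ k) (hil : i ≠ l) (hjk : j ≠ k) (hjl : j ≠ l) (hkl : k ≠ l) :
    PermBounded (diagTwirl μ fun a => eqInd i j a * eqInd k l a) (100 / (d : ℝ) ^ 2) := by
  have c4 : ({i, j, k, l} : Finset ι).card = 4 := by
    rw [Finset.card_insert_of_notMem (by simp [hij, hik, hil]),
      Finset.card_insert_of_notMem (by simp [hjk, hjl]), Finset.card_pair hkl]
  have e : (fun a : ι → Fin d => eqInd i j a * eqInd k l a) =
      fun a => ∑ b, ∑ c, fixedRows {i, j, k, l} (rowPair i j b c) a := by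
    funext a
    rw [eqInd, eqInd, ← fixedRows_pair_sum, ← fixedRows_pair_sum, Finset.sum_mul_sum]
    refine Finset.sum_congr rfl fun b _ => Finset.sum_congr rfl fun c _ => ?_
    simp only [fixedRows, rowPair, Finset.mem_insert, Finset.mem_singleton, forall_eq_or_imp,
      forall_eq, true_or, or_true, if_true, hik.symm, hjk.symm, hil.symm, hjl.symm, or_self,
      if_false, ← ite_and, mul_ite, mul_one, mul_zero]
    refine if_congr ?_ rfl rfl
    tauto
  rw [e]
  have e2 : diagTwirl μ (fun a : ι → Fin d =>
      ∑ b, ∑ c, fixedRows {i, j, k, l} (rowPair i j b c) a) = fun x y => ∑ b : Fin d, ∑ c : Fin d,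
      diagTwirl (haarU d) (fixedRows {i, j, k, l} (rowPair i j b c)) x y := by
    funext x y
    rw [diagTwirl_sum]
    refine Finset.sum_congr rfl fun b _ => ?_
    rw [diagTwirl_sum]
    exact Finset.sum_congr rfl fun c _ => hμ.diagTwirl_fixedRows_eq hd _ c4.le _ _ _
  rw [e2]
  refine (PermBounded.sum Finset.univ fun b _ =>
    diagTwirl_rowPair_sum hd b hij hik hil hjk hjl hkl).mono (le_of_eq ?_)
  have : (0 : ℝ) < d := by exact_mod_cast hd
  simp
  field_simp

lemma X_eq (a a' : Fin d) : X a a' = -1 + (d + 1) * if a = a' then 1 else 0 := by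
  unfold X
  split_ifs <;> simp

lemma X_sq (a a' : Fin d) : X a a' ^ 2 = 1 + ((d : ℝ) ^ 2 - 1) * if a = a' then 1 else 0 := by
  rw [X_eq]
  split_ifs <;> ring

lemma permBounded_const_one (hμ : IsUnitaryDesign 4 μ) :
    PermBounded (diagTwirl μ fun _ : ι → Fin d => 1) 1 := by
  have := hμ.isProbabilityMeasure
  have e2 : diagTwirl μ (fun _ : ι → Fin d => (1 : ℝ)) =
      fun x y => if x = y then (1 : ℂ) else 0 := by
    funext x y
    have h := diagTwirl_fixedRows μ ∅ x x y
    have e3 : (fixedRows ∅ x : (ι → Fin d) → ℝ) = fun _ => 1 := by funext a; simp [fixedRows]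
    rw [e3] at h
    rw [h]
    simp [mean_one, funext_iff]
  rw [e2]
  exact permBounded_one

/-- The coefficient d² - 1 of δ in X² meets an average of size 2/d, which leaves order d. -/
lemma permBounded_X_sq (hμ : IsUnitaryDesign 4 μ) (hd : 0 < d) {i j : ι} (hij : i ≠ j) :
    PermBounded (diagTwirl μ fun a => X (a i) (a j) * X (a i) (a j)) (3 * d) := by
  have hd1 : (1 : ℝ) ≤ d := by exact_mod_cast hd
  have e : diagTwirl μ (fun a : ι → Fin d => X (a i) (a j) * X (a i) (a j)) = fun x y =>
      diagTwirl μ (fun _ => 1) x y + (((d : ℝ) ^ 2 - 1 : ℝ) : ℂ) * diagTwirl μ (eqInd i j) x y := by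
    funext x y
    rw [← diagTwirl_const_mul, ← diagTwirl_add]
    congr 1
    funext a
    rw [← pow_two, X_sq, eqInd]
  rw [e]
  refine ((permBounded_const_one hμ).add ((permBounded_eqInd hμ hd hij).const_mul _)).mono ?_
  rw [Complex.norm_real, Real.norm_eq_abs, abs_of_nonneg (by nlinarith), mul_div_assoc', ← sub_nonneg]
  have : 3 * (d : ℝ) - (1 + ((d : ℝ) ^ 2 - 1) * 2 / d) = (d ^ 2 - d + 2) / d := by
    field_simp; ring
  rw [this]
  have : (0 : ℝ) ≤ d ^ 2 - d + 2 := by nlinarith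
  positivity

lemma permBounded_X_mul_X_aux (hμ : IsUnitaryDesign 4 μ) (hd : 0 < d) {i j k l : ι} (hij : i ≠ j)
    (hkl : k ≠ l)
    (h : PermBounded (diagTwirl μ fun a => eqInd i j a * eqInd k l a) (100 / (d : ℝ) ^ 2)) :
    PermBounded (diagTwirl μ fun a => X (a i) (a j) * X (a k) (a l)) 500 := by
  have hd1 : (1 : ℝ) ≤ d := by exact_mod_cast hd
  have e : diagTwirl μ (fun a : ι → Fin d => X (a i) (a j) * X (a k) (a l)) = fun x y =>
      diagTwirl μ (fun _ => 1) x y + ((-(d + 1) : ℝ) : ℂ) * diagTwirl μ (eqInd i j) x y +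
      ((-(d + 1) : ℝ) : ℂ) * diagTwirl μ (eqInd k l) x y +
      (((d + 1) ^ 2 : ℝ) : ℂ) * diagTwirl μ (fun a => eqInd i j a * eqInd k l a) x y := by
    funext x y
    rw [← diagTwirl_const_mul, ← diagTwirl_const_mul, ← diagTwirl_const_mul, ← diagTwirl_add,
      ← diagTwirl_add, ← diagTwirl_add]
    congr 1
    funext a
    rw [X_eq, X_eq, eqInd, eqInd]
    ring
  rw [e]
  refine ((((permBounded_const_one hμ).add ((permBounded_eqInd hμ hd hij).const_mul _)).add
    ((permBounded_eqInd hμ hd hkl).const_mul _)).add (h.const_mul _)).mono ?_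
  rw [Complex.norm_real, Complex.norm_real, Real.norm_eq_abs, Real.norm_eq_abs, abs_neg,
    abs_of_nonneg (by positivity), abs_of_nonneg (by positivity)]
  -- With d + 1 ≤ 2d the four terms of the expansion cost at most 1 + 4 + 4 + 400.
  have h1 : ((d : ℝ) + 1) * (2 / d) ≤ 4 := by
    rw [mul_div_assoc', div_le_iff₀ (by positivity)]; linarith
  have h2 : ((d : ℝ) + 1) ^ 2 * (100 / d ^ 2) ≤ 400 := by
    rw [mul_div_assoc', div_le_iff₀ (by positivity)]; nlinarith
  linarith

/-- The average of a product of two correlation kernels is of order one, unless the kernels act on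
the same pair of tensor factors, in which case it is of order `d`. -/
theorem permBounded_X_mul_X (hμ : IsUnitaryDesign 4 μ) (hd : 0 < d) {i j k l : ι} (hij : i ≠ j)
    (hkl : k ≠ l) (hcross : ¬(i = l ∧ j = k)) :
    PermBounded (diagTwirl μ fun a => X (a i) (a j) * X (a k) (a l))
      (500 * if i = k ∧ j = l then (d : ℝ) else 1) := by
  have hd1 : (1 : ℝ) ≤ d := by exact_mod_cast hd
  by_cases hsame : i = k ∧ j = l
  · obtain ⟨rfl, rfl⟩ := hsame
    simpa using (permBounded_X_sq hμ hd hij).mono (by linarith)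
  rw [if_neg hsame, mul_one]
  refine permBounded_X_mul_X_aux hμ hd hij hkl ?_
  by_cases hik : i = k
  · subst hik
    exact permBounded_eqInd_mul_of_shared hμ hd hij hkl (by tauto)
  by_cases hjl : j = l
  · subst hjl
    rw [eqInd_comm i j, eqInd_comm k j]
    exact permBounded_eqInd_mul_of_shared hμ hd hij.symm hkl.symm hik
  by_cases hil : i = l
  · subst hil
    rw [eqInd_comm k i]
    exact permBounded_eqInd_mul_of_shared hμ hd hij hkl.symm (by tauto)
  by_cases hjk : j = k
  · subst hjk
    rw [eqInd_comm i j]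
    exact permBounded_eqInd_mul_of_shared hμ hd hij.symm hkl hil
  exact permBounded_eqInd_mul_of_disjoint hμ hd hij hik hil hjk hjl hkl

end LetterBound

/-! ### Expectations of product observables -/

section Schur

variable {d : ℕ} {ι : Type*} [Fintype ι] [DecidableEq ι]

/-- A permutation matrix has exactly one nonzero entry in each row. With the column version below,
this is the input to a Schur test. -/
lemma PermBounded.sum_norm_right {φ : (ι → Fin d) → (ι → Fin d) → ℂ} {K : ℝ}
    (h : PermBounded φ K) (x : ι → Fin d) : ∑ y, ‖φ x y‖ ≤ K := by
  obtain ⟨c, hc, h⟩ := h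
  calc ∑ y, ‖φ x y‖ ≤ ∑ y, ∑ σ : Equiv.Perm ι, if x = y ∘ σ then ‖c σ‖ else 0 := by
        refine Finset.sum_le_sum fun y _ => ?_
        rw [h]
        refine (norm_sum_le _ _).trans (Finset.sum_le_sum fun σ _ => ?_)
        split_ifs <;> simp
    _ = ∑ σ : Equiv.Perm ι, ‖c σ‖ := by
        rw [Finset.sum_comm]
        refine Finset.sum_congr rfl fun σ _ => ?_
        rw [Finset.sum_eq_single (x ∘ σ.symm)]
        · simp [Function.comp_assoc]
        · intro y _ hy
          refine if_neg fun hx => hy ?_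
          simp [hx, Function.comp_assoc]
        · simp
    _ ≤ K := hc

lemma PermBounded.sum_norm_left {φ : (ι → Fin d) → (ι → Fin d) → ℂ} {K : ℝ}
    (h : PermBounded φ K) (y : ι → Fin d) : ∑ x, ‖φ x y‖ ≤ K := by
  obtain ⟨c, hc, h⟩ := h
  calc ∑ x, ‖φ x y‖ ≤ ∑ x, ∑ σ : Equiv.Perm ι, if x = y ∘ σ then ‖c σ‖ else 0 := by
        refine Finset.sum_le_sum fun x _ => ?_
        rw [h]
        refine (norm_sum_le _ _).trans (Finset.sum_le_sum fun σ _ => ?_)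
        split_ifs <;> simp
    _ = ∑ σ : Equiv.Perm ι, ‖c σ‖ := by
        rw [Finset.sum_comm]
        simp
    _ ≤ K := hc

end Schur

section Expectation

variable {d N : ℕ} {ρ : Matrix (Outcome d) (Outcome d) ℂ}

lemma IsState.diag_nonneg (hρ : IsState ρ) (s : Outcome d) : 0 ≤ (ρ s s).re :=
  (Complex.le_def.1 hρ.posSemidef.diag_nonneg).1

lemma IsState.sum_diag (hρ : IsState ρ) : ∑ s, (ρ s s).re = 1 := by
  have h := congrArg Complex.re hρ.trace_eq_one
  simpa [Matrix.trace] using h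

lemma IsState.dim_pos (hρ : IsState ρ) : 0 < d := by
  rcases Nat.eq_zero_or_pos d with rfl | h
  · have := hρ.sum_diag
    simp at this
  · exact h

/-- Nonnegativity of the 2 × 2 principal minor at x, y. -/
lemma IsState.norm_sq_le (hρ : IsState ρ) (x y : Outcome d) :
    ‖ρ x y‖ ^ 2 ≤ (ρ x x).re * (ρ y y).re := by
  have h := (hρ.posSemidef.submatrix ![x, y]).det_nonneg
  have him : ∀ s, (ρ s s).im = 0 := fun s =>
    ((Complex.le_def.1 hρ.posSemidef.diag_nonneg).2).symm
  have hyx : ρ y x = star (ρ x y) := (hρ.posSemidef.isHermitian.apply y x).symm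
  rw [Matrix.det_fin_two] at h
  simp only [Matrix.submatrix_apply, Matrix.cons_val_zero, Matrix.cons_val_one] at h
  rw [hyx] at h
  have h1 := (Complex.le_def.1 h).1
  simp only [Complex.zero_re, Complex.sub_re, Complex.mul_re, Complex.star_def, Complex.conj_re,
    Complex.conj_im, him] at h1
  rw [Complex.sq_norm, Complex.normSq_apply]
  linarith

/-- The geometric mean of the two diagonal products is replaced by their arithmetic mean, so that
each half can be summed against a row or a column of the kernel. -/
lemma IsState.norm_prod_le (hρ : IsState ρ) (x y : Fin N → Outcome d) :
    ‖∏ n, ρ (x n) (y n)‖ ≤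
      (∏ n, (ρ (x n) (x n)).re + ∏ n, (ρ (y n) (y n)).re) / 2 := by
  have hx : 0 ≤ ∏ n, (ρ (x n) (x n)).re := Finset.prod_nonneg fun n _ => hρ.diag_nonneg _
  have hy : 0 ≤ ∏ n, (ρ (y n) (y n)).re := Finset.prod_nonneg fun n _ => hρ.diag_nonneg _
  refine le_of_sq_le_sq ?_ (by positivity)
  have : ‖∏ n, ρ (x n) (y n)‖ ^ 2 ≤ (∏ n, (ρ (x n) (x n)).re) * ∏ n, (ρ (y n) (y n)).re := by
    rw [norm_prod, ← Finset.prod_pow, ← Finset.prod_mul_distrib]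
    exact Finset.prod_le_prod (fun _ _ => by positivity) fun n _ => hρ.norm_sq_le _ _
  nlinarith [sq_nonneg (∏ n, (ρ (x n) (x n)).re - ∏ n, (ρ (y n) (y n)).re)]

lemma IsState.sum_prod_diag (hρ : IsState ρ) :
    ∑ x : Fin N → Outcome d, ∏ n, (ρ (x n) (x n)).re = 1 := by
  rw [← Fintype.piFinset_univ, Finset.sum_prod_piFinset Finset.univ
    (fun (_ : Fin N) s => (ρ s s).re)]
  simp [hρ.sum_diag]

/-- Records of outcomes as triples of records of local outcomes. -/
def recordEquiv (d N : ℕ) :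
    (Fin N → Outcome d) ≃ (Fin N → Fin d) × (Fin N → Fin d) × (Fin N → Fin d) :=
  (Equiv.arrowProdEquivProdArrow _ _ _).trans
    (Equiv.prodCongr (Equiv.refl _) (Equiv.arrowProdEquivProdArrow _ _ _))

lemma sum_record_mul {R : Type*} [CommSemiring R] (f g h : (Fin N → Fin d) → R) :
    ∑ s : Fin N → Outcome d,
      f (fun n => (s n).1) * (g (fun n => (s n).2.1) * h (fun n => (s n).2.2)) =
      (∑ a, f a) * ((∑ b, g b) * ∑ c, h c) := by
  refine (Fintype.sum_equiv (recordEquiv d N) _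
    (fun p : (Fin N → Fin d) × (Fin N → Fin d) × (Fin N → Fin d) => f p.1 * (g p.2.1 * h p.2.2))
    (fun s => rfl)).trans ?_
  simp only [Fintype.sum_prod_type]
  simp only [← Finset.mul_sum, ← Finset.sum_mul]

lemma toMatrix_apply (U : LocalUnitary d) (s x : Outcome d) :
    U.toMatrix s x = entry s.1 x.1 U.1 * (entry s.2.1 x.2.1 U.2.1 * entry s.2.2 x.2.2 U.2.2) := rfl

lemma born_nonneg (hρ : IsState ρ) (U : LocalUnitary d) (s : Outcome d) : 0 ≤ born ρ U s :=
  (Complex.le_def.1 (hρ.posSemidef.mul_mul_conjTranspose_same U.toMatrix).diag_nonneg).1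

lemma ofReal_born (hρ : IsState ρ) (U : LocalUnitary d) (s : Outcome d) :
    (born ρ U s : ℂ) = (U.toMatrix * ρ * U.toMatrixᴴ) s s := by
  refine Complex.ext rfl ?_
  exact (Complex.le_def.1 (hρ.posSemidef.mul_mul_conjTranspose_same U.toMatrix).diag_nonneg).2

lemma ofReal_born_eq_sum (hρ : IsState ρ) (U : LocalUnitary d) (s : Outcome d) :
    (born ρ U s : ℂ) = ∑ p : Outcome d × Outcome d, ρ p.1 p.2 *
      (U.toMatrix s p.1 * star (U.toMatrix s p.2)) := by
  rw [ofReal_born hρ, Matrix.mul_apply]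
  refine Eq.trans ?_ (Fintype.sum_prod_type_right _).symm
  refine Finset.sum_congr rfl fun y _ => ?_
  rw [Matrix.mul_apply, Finset.sum_mul]
  refine Finset.sum_congr rfl fun x _ => ?_
  rw [Matrix.conjTranspose_apply]
  ring

lemma sum_born (hρ : IsState ρ) (U : LocalUnitary d) : ∑ s, born ρ U s = 1 := by
  have hU : U.toMatrixᴴ * U.toMatrix = 1 := by
    have h : ∀ V : UGroup d, (V : Matrix (Fin d) (Fin d) ℂ)ᴴ * (V : Matrix (Fin d) (Fin d) ℂ) = 1 :=
      fun V => Matrix.UnitaryGroup.star_mul_self V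
    rw [LocalUnitary.toMatrix, Matrix.conjTranspose_kronecker, Matrix.conjTranspose_kronecker,
      ← Matrix.mul_kronecker_mul, ← Matrix.mul_kronecker_mul, h, h, h]
    simp
  have h : ((∑ s, born ρ U s : ℝ) : ℂ) = 1 := by
    push_cast
    simp only [ofReal_born hρ]
    change (U.toMatrix * ρ * U.toMatrixᴴ).trace = 1
    rw [Matrix.trace_mul_comm, ← Matrix.mul_assoc, hU, Matrix.one_mul, hρ.trace_eq_one]
  exact_mod_cast h

lemma continuous_born (ρ : Matrix (Outcome d) (Outcome d) ℂ) (s : Outcome d) :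
    Continuous fun U : LocalUnitary d => born ρ U s := by
  have h : ∀ s x : Outcome d, Continuous fun U : LocalUnitary d => U.toMatrix s x := by
    intro s x
    simp only [toMatrix_apply]
    exact ((entry s.1 x.1).continuous.comp continuous_fst).mul
      (((entry s.2.1 x.2.1).continuous.comp (continuous_fst.comp continuous_snd)).mul
        ((entry s.2.2 x.2.2).continuous.comp (continuous_snd.comp continuous_snd)))
  simp only [born, Matrix.mul_apply, Matrix.conjTranspose_apply]
  refine Complex.continuous_re.comp (continuous_finsetSum _ fun y _ => ?_)
  exact (continuous_finsetSum _ fun x _ => (h s x).mul continuous_const).mul (h s y).star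

variable {μA μB μC : Measure (UGroup d)}

lemma integrable_of_continuous [IsFiniteMeasure μA] [IsFiniteMeasure μB] [IsFiniteMeasure μC]
    {E : Type*} [NormedAddCommGroup E] {f : LocalUnitary d → E} (hf : Continuous f) :
    Integrable f (μA.prod (μB.prod μC)) :=
  hf.integrable_of_hasCompactSupport (HasCompactSupport.of_compactSpace _)

lemma continuous_expect_integrand (ρ : Matrix (Outcome d) (Outcome d) ℂ)
    (f : (Fin N → Outcome d) → ℝ) :
    Continuous fun U : LocalUnitary d => ∑ s : Fin N → Outcome d, (∏ n, born ρ U (s n)) * f s :=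
  continuous_finsetSum _ fun s _ =>
    (continuous_finsetProd _ fun n _ => continuous_born ρ (s n)).mul continuous_const

/-- A diagonal observable on the tensor factors, in the random basis. -/
def diagObs {ι : Type*} [Fintype ι] [DecidableEq ι] (f : (ι → Fin d) → ℝ) (x y : ι → Fin d) :
    C(UGroup d, ℂ) :=
  ∑ a : ι → Fin d, (f a : ℂ) • ∏ n, (entry (a n) (x n) * star (entry (a n) (y n)))

/-- Each Born probability is expanded into matrix elements of ρ. As entries of U_A ⊗ U_B ⊗ U_C are
products, the sum over records splits into three local sums. -/
lemma expect_integrand_eq (hρ : IsState ρ) (fA fB fC : (Fin N → Fin d) → ℝ) (U : LocalUnitary d) :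
    ((∑ s : Fin N → Outcome d, (∏ n, born ρ U (s n)) *
      (fA (fun n => (s n).1) * fB (fun n => (s n).2.1) * fC (fun n => (s n).2.2)) : ℝ) : ℂ) =
    ∑ p : Fin N → Outcome d × Outcome d, (∏ n, ρ (p n).1 (p n).2) *
      (diagObs fA (fun n => (p n).1.1) (fun n => (p n).2.1) U.1 *
        (diagObs fB (fun n => (p n).1.2.1) (fun n => (p n).2.2.1) U.2.1 *
          diagObs fC (fun n => (p n).1.2.2) (fun n => (p n).2.2.2) U.2.2)) := by
  push_cast
  have h1 : ∀ s : Fin N → Outcome d, ∏ n, (born ρ U (s n) : ℂ) =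
      ∑ p : Fin N → Outcome d × Outcome d, ∏ n, (ρ (p n).1 (p n).2 *
        (U.toMatrix (s n) (p n).1 * star (U.toMatrix (s n) (p n).2))) := by
    intro s
    simp only [ofReal_born_eq_sum hρ]
    rw [Finset.prod_univ_sum, Fintype.piFinset_univ]
  simp only [h1, Finset.sum_mul]
  rw [Finset.sum_comm]
  refine Finset.sum_congr rfl fun p _ => ?_
  simp only [diagObs, ContinuousMap.sum_apply, ContinuousMap.smul_apply, ContinuousMap.prod_apply,
    ContinuousMap.mul_apply, ContinuousMap.star_apply, smul_eq_mul]
  rw [← sum_record_mul, Finset.mul_sum]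
  refine Finset.sum_congr rfl fun s _ => ?_
  simp only [toMatrix_apply, Finset.prod_mul_distrib, star_mul']
  ring

lemma expect_eq_sum (hρ : IsState ρ) [IsProbabilityMeasure μA] [IsProbabilityMeasure μB]
    [IsProbabilityMeasure μC] (fA fB fC : (Fin N → Fin d) → ℝ) :
    ((expect N μA μB μC ρ fun s =>
      fA (fun n => (s n).1) * fB (fun n => (s n).2.1) * fC (fun n => (s n).2.2) : ℝ) : ℂ) =
    ∑ p : Fin N → Outcome d × Outcome d, (∏ n, ρ (p n).1 (p n).2) *
      (diagTwirl μA fA (fun n => (p n).1.1) (fun n => (p n).2.1) *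
        (diagTwirl μB fB (fun n => (p n).1.2.1) (fun n => (p n).2.2.1) *
          diagTwirl μC fC (fun n => (p n).1.2.2) (fun n => (p n).2.2.2))) := by
  rw [expect, ← integral_complex_ofReal]
  simp only [expect_integrand_eq hρ]
  rw [integral_finsetSum]
  · refine Finset.sum_congr rfl fun p _ => ?_
    rw [integral_const_mul, integral_prod_mul (μ := μA) (ν := μB.prod μC)
      (fun U => diagObs fA (fun n => (p n).1.1) (fun n => (p n).2.1) U)
      (fun V : UGroup d × UGroup d => diagObs fB (fun n => (p n).1.2.1) (fun n => (p n).2.2.1) V.1 *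
          diagObs fC (fun n => (p n).1.2.2) (fun n => (p n).2.2.2) V.2),
      integral_prod_mul]
    rfl
  · intro p _
    refine integrable_of_continuous (continuous_const.mul ?_)
    exact ((diagObs fA _ _).continuous.comp continuous_fst).mul
      (((diagObs fB _ _).continuous.comp (continuous_fst.comp continuous_snd)).mul
        ((diagObs fC _ _).continuous.comp (continuous_snd.comp continuous_snd)))

/-- The expectation of a product of local diagonal observables is bounded by the product of the
sizes of their averages. -/
theorem abs_expect_le (hρ : IsState ρ) [IsProbabilityMeasure μA] [IsProbabilityMeasure μB]
    [IsProbabilityMeasure μC] {fA fB fC : (Fin N → Fin d) → ℝ} {KA KB KC : ℝ}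
    (hA : PermBounded (diagTwirl μA fA) KA) (hB : PermBounded (diagTwirl μB fB) KB)
    (hC : PermBounded (diagTwirl μC fC) KC) :
    |expect N μA μB μC ρ fun s =>
      fA (fun n => (s n).1) * fB (fun n => (s n).2.1) * fC (fun n => (s n).2.2)| ≤
      KA * (KB * KC) := by
  rw [← Real.norm_eq_abs, ← Complex.norm_real, expect_eq_sum hρ]
  set φA := diagTwirl μA fA
  set φB := diagTwirl μB fB
  set φC := diagTwirl μC fC
  let x0 : Fin N → Fin d := fun _ => ⟨0, hρ.dim_pos⟩
  have hA0 : 0 ≤ KA := (Finset.sum_nonneg fun _ _ => norm_nonneg _).trans (hA.sum_norm_right x0)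
  have hB0 : 0 ≤ KB := (Finset.sum_nonneg fun _ _ => norm_nonneg _).trans (hB.sum_norm_right x0)
  have hC0 : 0 ≤ KC := (Finset.sum_nonneg fun _ _ => norm_nonneg _).trans (hC.sum_norm_right x0)
  let k : (Fin N → Outcome d) → (Fin N → Outcome d) → ℝ := fun x y =>
    ‖φA (fun n => (x n).1) (fun n => (y n).1)‖ * (‖φB (fun n => (x n).2.1) (fun n => (y n).2.1)‖ *
      ‖φC (fun n => (x n).2.2) (fun n => (y n).2.2)‖)
  have hright : ∀ x, ∑ y, k x y ≤ KA * (KB * KC) := by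
    intro x
    rw [sum_record_mul (fun a => ‖φA (fun n => (x n).1) a‖) (fun a => ‖φB (fun n => (x n).2.1) a‖)
      (fun a => ‖φC (fun n => (x n).2.2) a‖)]
    have := hA.sum_norm_right fun n => (x n).1
    have := hB.sum_norm_right fun n => (x n).2.1
    have := hC.sum_norm_right fun n => (x n).2.2
    gcongr
  have hleft : ∀ y, ∑ x, k x y ≤ KA * (KB * KC) := by
    intro y
    rw [sum_record_mul (fun a => ‖φA a (fun n => (y n).1)‖) (fun a => ‖φB a (fun n => (y n).2.1)‖)
      (fun a => ‖φC a (fun n => (y n).2.2)‖)]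
    have := hA.sum_norm_left fun n => (y n).1
    have := hB.sum_norm_left fun n => (y n).2.1
    have := hC.sum_norm_left fun n => (y n).2.2
    gcongr
  let P : (Fin N → Outcome d) → ℝ := fun x => ∏ n, (ρ (x n) (x n)).re
  have hP : ∀ x, 0 ≤ P x := fun x => Finset.prod_nonneg fun n _ => hρ.diag_nonneg _
  have hP1 : ∑ x, P x = 1 := hρ.sum_prod_diag
  have hsplit : ∑ p : Fin N → Outcome d × Outcome d, (∏ n, ρ (p n).1 (p n).2) *
      (φA (fun n => (p n).1.1) (fun n => (p n).2.1) *
        (φB (fun n => (p n).1.2.1) (fun n => (p n).2.2.1) *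
          φC (fun n => (p n).1.2.2) (fun n => (p n).2.2.2))) =
      ∑ x : Fin N → Outcome d, ∑ y : Fin N → Outcome d, (∏ n, ρ (x n) (y n)) *
        (φA (fun n => (x n).1) (fun n => (y n).1) *
          (φB (fun n => (x n).2.1) (fun n => (y n).2.1) *
            φC (fun n => (x n).2.2) (fun n => (y n).2.2))) := by
    rw [← Fintype.sum_prod_type']
    exact Fintype.sum_equiv (Equiv.arrowProdEquivProdArrow (Fin N) (fun _ => Outcome d)
      (fun _ => Outcome d)) _ _ (fun p => rfl)
  rw [hsplit]
  -- Schur test: the rows and columns of k sum to at most KA KB KC, and the diagonal weights P sum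
  -- to 1.
  calc _ ≤ ∑ x, ∑ y, (P x + P y) / 2 * k x y := by
        refine (norm_sum_le _ _).trans (Finset.sum_le_sum fun x _ =>
          (norm_sum_le _ _).trans (Finset.sum_le_sum fun y _ => ?_))
        rw [norm_mul, norm_mul, norm_mul]
        exact mul_le_mul_of_nonneg_right (hρ.norm_prod_le x y) (by positivity)
    _ = (∑ x, P x * ∑ y, k x y + ∑ y, P y * ∑ x, k x y) / 2 := by
        simp only [Finset.mul_sum]
        rw [Finset.sum_comm (f := fun y x => P y * k x y), ← Finset.sum_add_distrib,
          Finset.sum_div]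
        refine Finset.sum_congr rfl fun x _ => ?_
        rw [← Finset.sum_add_distrib, Finset.sum_div]
        exact Finset.sum_congr rfl fun y _ => by ring
    _ ≤ (∑ x, P x * (KA * (KB * KC)) + ∑ y, P y * (KA * (KB * KC))) / 2 := by
        gcongr with x _ y _
        · exact hP x
        · exact hright x
        · exact hP y
        · exact hleft y
    _ = KA * (KB * KC) := by
        rw [← Finset.sum_mul, hP1]; ring

end Expectation

/-! ### The second moment of a single kernel -/

section LowerBound

variable {d N : ℕ}

/-- AM-GM for the four numbers ABC, D⁴/A, D⁴/B, D⁴/C, whose product is D¹². It bounds ABC from below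
by separate functions of A, B and C, which can be averaged even when these are correlated. -/
lemma four_mul_cube_le {D A B C : ℝ} (hD : 0 < D) (hA : 0 < A) (hB : 0 < B) (hC : 0 < C) :
    4 * D ^ 3 ≤ A * B * C + D ^ 4 * (A⁻¹ + B⁻¹ + C⁻¹) := by
  have amgm : ∀ x y : ℝ, 4 * (x * y) ≤ (x + y) ^ 2 := fun x y => by nlinarith [sq_nonneg (x - y)]
  set x := A * B * C with hx
  set y := D ^ 4 * A⁻¹ with hy
  set z := D ^ 4 * B⁻¹ with hz
  set w := D ^ 4 * C⁻¹ with hw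
  have hx0 : 0 < x := by positivity
  have hy0 : 0 < y := by positivity
  have hz0 : 0 < z := by positivity
  have hw0 : 0 < w := by positivity
  have hprod : x * y * (z * w) = D ^ 12 := by
    rw [hx, hy, hz, hw]; field_simp
  have h1 : (4 * D ^ 3) ^ 4 ≤ (x + y + (z + w)) ^ 4 := by
    calc (4 * D ^ 3) ^ 4 = 16 * ((4 * (x * y)) * (4 * (z * w))) := by
          rw [show 16 * ((4 * (x * y)) * (4 * (z * w))) = 256 * (x * y * (z * w)) by ring, hprod]
          ring
      _ ≤ 16 * ((x + y) ^ 2 * (z + w) ^ 2) := by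
          gcongr
          · exact amgm x y
          · exact amgm z w
      _ = (4 * ((x + y) * (z + w))) ^ 2 := by ring
      _ ≤ ((x + y + (z + w)) ^ 2) ^ 2 := by
          gcongr
          exact amgm _ _
      _ = (x + y + (z + w)) ^ 4 := by ring
  have h2 := le_of_pow_le_pow_left₀ (by norm_num) (by positivity) h1
  calc 4 * D ^ 3 ≤ x + y + (z + w) := h2
    _ = x + D ^ 4 * (A⁻¹ + B⁻¹ + C⁻¹) := by rw [hy, hz, hw]; ring

variable {Ω : Type*} [Fintype Ω] {p : Ω → ℝ}

lemma sum_mul_X_sq (hp1 : ∑ t, p t = 1) (π : Ω → Fin d) (a : Fin d) :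
    ∑ t, p t * X a (π t) ^ 2 = 1 + ((d : ℝ) ^ 2 - 1) * ∑ t, if π t = a then p t else 0 := by
  simp only [X_sq, mul_add, mul_one, Finset.sum_add_distrib, hp1, Finset.mul_sum]
  congr 1
  refine Finset.sum_congr rfl fun t _ => ?_
  by_cases h : π t = a
  · simp [h]; ring
  · simp [h, Ne.symm h]

lemma sum_mul_X_sq_pos (hd : 0 < d) (hp : ∀ t, 0 ≤ p t) (hp1 : ∑ t, p t = 1) (π : Ω → Fin d)
    (a : Fin d) : 0 < ∑ t, p t * X a (π t) ^ 2 := by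
  have hd1 : (1 : ℝ) ≤ d := by exact_mod_cast hd
  rw [sum_mul_X_sq hp1]
  have h0 : 0 ≤ ∑ t, (if π t = a then p t else 0) :=
    Finset.sum_nonneg fun t _ => by split_ifs <;> simp [hp]
  have : 0 ≤ ((d : ℝ) ^ 2 - 1) * ∑ t, (if π t = a then p t else 0) :=
    mul_nonneg (by nlinarith) h0
  linarith

/-- Grouped by the value a of π, with marginal weight P_a, the sum is Σ_a P_a / (1 + (d²-1)P_a).
Each of the d terms is at most 1/d², since P_a ≤ 1. -/
lemma sum_mul_inv_le (hd : 0 < d) (hp : ∀ t, 0 ≤ p t) (hp1 : ∑ t, p t = 1) (π : Ω → Fin d) :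
    ∑ w, p w * (∑ t, p t * X (π w) (π t) ^ 2)⁻¹ ≤ (d : ℝ)⁻¹ := by
  have hd1 : (1 : ℝ) ≤ d := by exact_mod_cast hd
  calc ∑ w, p w * (∑ t, p t * X (π w) (π t) ^ 2)⁻¹
      = ∑ w, ∑ a, (if π w = a then p w else 0) * (∑ t, p t * X a (π t) ^ 2)⁻¹ := by
        refine Finset.sum_congr rfl fun w _ => ?_
        simp [ite_mul]
    _ = ∑ a, (∑ w, if π w = a then p w else 0) * (∑ t, p t * X a (π t) ^ 2)⁻¹ := by
        rw [Finset.sum_comm]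
        simp only [Finset.sum_mul]
    _ ≤ ∑ _a : Fin d, ((d : ℝ) ^ 2)⁻¹ := by
        refine Finset.sum_le_sum fun a _ => ?_
        have hpos := sum_mul_X_sq_pos hd hp hp1 π a
        rw [← div_eq_mul_inv, div_le_iff₀ hpos, sum_mul_X_sq hp1]
        have h1 : ∑ t, (if π t = a then p t else 0) ≤ 1 := by
          rw [← hp1]
          refine Finset.sum_le_sum fun t _ => ?_
          split_ifs
          exacts [le_rfl, hp t]
        rw [inv_mul_eq_div, le_div_iff₀ (by positivity)]
        linarith
    _ = (d : ℝ)⁻¹ := by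
        simp
        field_simp

variable [DecidableEq Ω]

/-- Marginalization to four of `N` independent outcomes, the first of which is singled out. -/
lemma sum_prod_mul_eq (hp1 : ∑ t, p t = 1) {i j k l : Fin N} (hij : i ≠ j) (hik : i ≠ k)
    (hil : i ≠ l) (hjk : j ≠ k) (hjl : j ≠ l) (hkl : k ≠ l) (f g h : Ω → Ω → ℝ) :
    ∑ s : Fin N → Ω, (∏ n, p (s n)) * (f (s i) (s j) * g (s i) (s k) * h (s i) (s l)) =
      ∑ w, p w * ((∑ t, p t * f w t) * (∑ t, p t * g w t) * ∑ t, p t * h w t) := by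
  -- Naming the outcome at i by w, through an indicator, turns the summand into a product over n, so
  -- the sum over records factorizes.
  let F : Ω → Fin N → Ω → ℝ := fun w n t =>
    (if n = i then if t = w then 1 else 0 else 1) * ((if n = j then f w t else 1) *
      ((if n = k then g w t else 1) * if n = l then h w t else 1))
  have h1 : ∀ s : Fin N → Ω, (∏ n, p (s n)) * (f (s i) (s j) * g (s i) (s k) * h (s i) (s l)) =
      ∑ w, ∏ n, p (s n) * F w n (s n) := by
    intro s
    simp only [F, Finset.prod_mul_distrib, Finset.prod_ite_eq', Finset.mem_univ, if_true]
    rw [← Finset.mul_sum]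
    congr 1
    simp [mul_assoc]
  simp only [h1]
  rw [Finset.sum_comm]
  refine Finset.sum_congr rfl fun w _ => ?_
  rw [← Fintype.piFinset_univ, Finset.sum_prod_piFinset Finset.univ (fun n t => p t * F w n t)]
  have h2 : ∀ n, ∑ t, p t * F w n t = (if n = i then p w else 1) *
      ((if n = j then ∑ t, p t * f w t else 1) * ((if n = k then ∑ t, p t * g w t else 1) *
        if n = l then ∑ t, p t * h w t else 1)) := by
    intro n
    by_cases hi : n = i
    · subst hi; simp [F, hij, hik, hil]
    by_cases hj : n = j
    · subst hj; simp [F, hi, hjk, hjl]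
    by_cases hk : n = k
    · subst hk; simp [F, hi, hj, hkl]
    by_cases hl : n = l
    · subst hl; simp [F, hi, hj, hk]
    simp [F, hi, hj, hk, hl, hp1]
  simp only [h2, Finset.prod_mul_distrib, Finset.prod_ite_eq', Finset.mem_univ, if_true]
  ring

end LowerBound

section SecondMoment

variable {d N : ℕ} {ρ : Matrix (Outcome d) (Outcome d) ℂ} {μA μB μC : Measure (UGroup d)}

/-- With D = d in `four_mul_cube_le`, averaging over the leading outcome gives at least 4d³ -
d⁴·(3/d) = d³. This holds for every U, so no design property enters. -/
lemma cube_le_sum_sample_sq (hρ : IsState ρ) (U : LocalUnitary d) {I : Fin 4 → Fin N}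
    (hI : Function.Injective I) :
    (d : ℝ) ^ 3 ≤ ∑ s : Fin N → Outcome d, (∏ n, born ρ U (s n)) * (sample I s * sample I s) := by
  have hd := hρ.dim_pos
  have hd0 : (0 : ℝ) < d := by exact_mod_cast hd
  have hp := born_nonneg hρ U
  have hp1 := sum_born hρ U
  have e : ∀ s : Fin N → Outcome d, sample I s * sample I s =
      X (s (I 0)).1 (s (I 1)).1 ^ 2 * X (s (I 0)).2.1 (s (I 2)).2.1 ^ 2 *
        X (s (I 0)).2.2 (s (I 3)).2.2 ^ 2 := by
    intro s
    simp only [sample, kernelQ]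
    ring
  simp only [e]
  refine le_of_le_of_eq ?_ (sum_prod_mul_eq hp1 (hI.ne (by decide)) (hI.ne (by decide))
    (hI.ne (by decide)) (hI.ne (by decide)) (hI.ne (by decide)) (hI.ne (by decide))
    (fun w t : Outcome d => X w.1 t.1 ^ 2) (fun w t : Outcome d => X w.2.1 t.2.1 ^ 2)
    (fun w t : Outcome d => X w.2.2 t.2.2 ^ 2) (i := I 0) (j := I 1) (k := I 2) (l := I 3)).symm
  have hA := sum_mul_inv_le hd hp hp1 fun w => w.1
  have hB := sum_mul_inv_le hd hp hp1 fun w => w.2.1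
  have hC := sum_mul_inv_le hd hp hp1 fun w => w.2.2
  have hA0 := sum_mul_X_sq_pos hd hp hp1 fun w => w.1
  have hB0 := sum_mul_X_sq_pos hd hp hp1 fun w => w.2.1
  have hC0 := sum_mul_X_sq_pos hd hp hp1 fun w => w.2.2
  generalize born ρ U = p at *
  calc (d : ℝ) ^ 3 = 4 * (d : ℝ) ^ 3 - (d : ℝ) ^ 4 * ((d : ℝ)⁻¹ + (d : ℝ)⁻¹ + (d : ℝ)⁻¹) := by
        field_simp; ring
    _ ≤ 4 * (d : ℝ) ^ 3 * ∑ w, p w - (d : ℝ) ^ 4 *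
        (∑ w, p w * (∑ t, p t * X w.1 t.1 ^ 2)⁻¹ + ∑ w, p w * (∑ t, p t * X w.2.1 t.2.1 ^ 2)⁻¹ +
          ∑ w, p w * (∑ t, p t * X w.2.2 t.2.2 ^ 2)⁻¹) := by
        rw [hp1, mul_one]
        gcongr
    _ = ∑ w, p w * (4 * (d : ℝ) ^ 3 - (d : ℝ) ^ 4 * ((∑ t, p t * X w.1 t.1 ^ 2)⁻¹ +
          (∑ t, p t * X w.2.1 t.2.1 ^ 2)⁻¹ + (∑ t, p t * X w.2.2 t.2.2 ^ 2)⁻¹)) := by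
        simp only [mul_sub, mul_add, Finset.sum_sub_distrib, Finset.sum_add_distrib, Finset.mul_sum]
        congr 1
        · exact Finset.sum_congr rfl fun _ _ => by ring
        · congr 1
          · congr 1 <;> exact Finset.sum_congr rfl fun _ _ => by ring
          · exact Finset.sum_congr rfl fun _ _ => by ring
    _ ≤ _ := by
        refine Finset.sum_le_sum fun w _ => mul_le_mul_of_nonneg_left ?_ (hp w)
        linarith [four_mul_cube_le hd0 (hA0 w.1) (hB0 w.2.1) (hC0 w.2.2)]

variable [IsProbabilityMeasure μA] [IsProbabilityMeasure μB] [IsProbabilityMeasure μC]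

lemma cube_le_expect_sample_sq (hρ : IsState ρ) {I : Fin 4 → Fin N} (hI : Function.Injective I) :
    (d : ℝ) ^ 3 ≤ expect N μA μB μC ρ fun s => sample I s * sample I s := by
  have h : ∫ _U : LocalUnitary d, (d : ℝ) ^ 3 ∂(μA.prod (μB.prod μC)) ≤
      expect N μA μB μC ρ fun s => sample I s * sample I s :=
    integral_mono (integrable_const _)
      (integrable_of_continuous (continuous_expect_integrand ρ _))
      fun U => cube_le_sum_sample_sq hρ U hI
  simpa using h

lemma expect_sum {α : Type*} (T : Finset α) (f : α → (Fin N → Outcome d) → ℝ) :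
    expect N μA μB μC ρ (fun s => ∑ a ∈ T, f a s) = ∑ a ∈ T, expect N μA μB μC ρ (f a) := by
  simp only [expect]
  rw [← integral_finsetSum _ fun a _ =>
    integrable_of_continuous (continuous_expect_integrand ρ (f a))]
  congr 1
  funext U
  rw [Finset.sum_comm]
  simp only [Finset.mul_sum]

omit [IsProbabilityMeasure μA] [IsProbabilityMeasure μB] [IsProbabilityMeasure μC] in
lemma expect_const_mul (c : ℝ) (f : (Fin N → Outcome d) → ℝ) :
    expect N μA μB μC ρ (fun s => c * f s) = c * expect N μA μB μC ρ f := by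
  simp only [expect]
  rw [← integral_const_mul]
  congr 1
  funext U
  rw [Finset.mul_sum]
  exact Finset.sum_congr rfl fun _ _ => by ring

end SecondMoment

/-! ### Pairs of quadruples -/

section Combinatorics

variable {N : ℕ}

lemma strictMono_of_mem_quads {I : Fin 4 → Fin N} (hI : I ∈ quads N) : StrictMono I := by
  simp only [quads, Finset.mem_filter, Finset.mem_univ, true_and] at hI
  rw [Fin.strictMono_iff_lt_succ]
  intro i
  fin_cases i
  exacts [hI.1, hI.2.1, hI.2.2]

lemma mem_quads_of_strictMono {I : Fin 4 → Fin N} (hI : StrictMono I) : I ∈ quads N := by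
  simp only [quads, Finset.mem_filter, Finset.mem_univ, true_and]
  exact ⟨hI (by decide), hI (by decide), hI (by decide)⟩

lemma eq_of_image_eq {I I' : Fin 4 → Fin N} (hI : I ∈ quads N) (hI' : I' ∈ quads N)
    (h : Finset.univ.image I = Finset.univ.image I') : I = I' := by
  refine ((strictMono_of_mem_quads hI).range_inj (strictMono_of_mem_quads hI')).1 ?_
  simpa using congrArg (fun s : Finset (Fin N) => (s : Set (Fin N))) h

lemma card_image_of_mem_quads {I : Fin 4 → Fin N} (hI : I ∈ quads N) :
    (Finset.univ.image I).card = 4 := by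
  rw [Finset.card_image_of_injective _ (strictMono_of_mem_quads hI).injective]
  simp

lemma card_quads (N : ℕ) : (quads N).card = N.choose 4 := by
  have h : (quads N).card = (Finset.powersetCard 4 (Finset.univ : Finset (Fin N))).card := by
    refine Finset.card_bij (fun I _ => Finset.univ.image I) ?_ ?_ ?_
    · intro I hI
      exact Finset.mem_powersetCard.2 ⟨Finset.subset_univ _, card_image_of_mem_quads hI⟩
    · intro I hI I' hI' h
      exact eq_of_image_eq hI hI' h
    · intro s hs
      have hs4 := (Finset.mem_powersetCard.1 hs).2
      refine ⟨s.orderEmbOfFin hs4, mem_quads_of_strictMono (s.orderEmbOfFin hs4).strictMono, ?_⟩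
      simp
  rw [h]
  simp

lemma coincidences_le {I I' : Fin 4 → Fin N} : coincidences I I' ≤ 4 :=
  (Finset.card_le_card Finset.inter_subset_left).trans
    (Finset.card_image_le.trans (by simp))

lemma leading_le (I I' : Fin 4 → Fin N) : leading I I' ≤ 2 := by
  unfold leading
  split_ifs <;> simp

lemma coincidences_self {I : Fin 4 → Fin N} (hI : I ∈ quads N) : coincidences I I = 4 := by
  rw [coincidences, Finset.inter_self, card_image_of_mem_quads hI]

lemma eq_of_coincidences_eq_four {I I' : Fin 4 → Fin N} (hI : I ∈ quads N) (hI' : I' ∈ quads N)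
    (h : coincidences I I' = 4) : I = I' := by
  rw [coincidences] at h
  refine eq_of_image_eq hI hI' ?_
  rw [← Finset.eq_of_subset_of_card_le Finset.inter_subset_left
    ((card_image_of_mem_quads hI).trans h.symm).le]
  exact Finset.eq_of_subset_of_card_le Finset.inter_subset_right
    ((card_image_of_mem_quads hI').trans h.symm).le

/-- The size of the expectation of `q_I q_{I'}`: a factor `d` for each tensor factor on which the
two kernels act on the same pair of copies. -/
def overlapFactor (d : ℕ) (I I' : Fin 4 → Fin N) (m : Fin 4) : ℝ :=
  if I 0 = I' 0 ∧ I m = I' m then d else 1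

lemma overlapFactor_prod_of_leading {d : ℕ} {I I' : Fin 4 → Fin N} (h : leading I I' ≠ 2) :
    overlapFactor d I I' 1 * (overlapFactor d I I' 2 * overlapFactor d I I' 3) = 1 := by
  have h0 : I 0 ≠ I' 0 := by
    intro h0
    refine h ?_
    rw [leading, if_pos ⟨0, h0⟩, if_pos ⟨0, h0⟩]
  simp [overlapFactor, h0]

/-- A factor d needs i = i', which already uses one coincidence. Without coincidences the truncated
exponent is 0. -/
lemma overlapFactor_prod_le {d : ℕ} (hd : 0 < d) {I I' : Fin 4 → Fin N} (hI : I ∈ quads N) :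
    overlapFactor d I I' 1 * (overlapFactor d I I' 2 * overlapFactor d I I' 3) ≤
      (d : ℝ) ^ (coincidences I I' - 1) := by
  have hd1 : (1 : ℝ) ≤ d := by exact_mod_cast hd
  by_cases h0 : I 0 = I' 0
  · have hcard : (Finset.univ.filter fun k => I k = I' k).card ≤ coincidences I I' := by
      rw [← Finset.card_image_of_injective _ (strictMono_of_mem_quads hI).injective, coincidences]
      refine Finset.card_le_card fun n hn => ?_
      obtain ⟨k, hk, rfl⟩ := Finset.mem_image.1 hn
      have hk' := (Finset.mem_filter.1 hk).2
      exact Finset.mem_inter.2 ⟨Finset.mem_image_of_mem _ (Finset.mem_univ _),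
        Finset.mem_image.2 ⟨k, Finset.mem_univ _, hk'.symm⟩⟩
    rw [Finset.card_filter, Fin.sum_univ_four, if_pos h0] at hcard
    have hprod : overlapFactor d I I' 1 * (overlapFactor d I I' 2 * overlapFactor d I I' 3) =
        (d : ℝ) ^ ((if I 1 = I' 1 then 1 else 0) + (if I 2 = I' 2 then 1 else 0) +
          (if I 3 = I' 3 then 1 else 0)) := by
      simp only [overlapFactor, h0, true_and, pow_add]
      split_ifs <;> simp [mul_assoc]
    rw [hprod]
    exact pow_le_pow_right₀ hd1 (by omega)
  · simp only [overlapFactor, h0, false_and, if_false, mul_one]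
    exact one_le_pow₀ hd1

end Combinatorics

/-! ### The variance terms -/

section Terms

variable {d N : ℕ} {ρ : Matrix (Outcome d) (Outcome d) ℂ} {μA μB μC : Measure (UGroup d)}

lemma abs_expect_sample_mul_le (hρ : IsState ρ) (hA : IsUnitaryDesign 4 μA)
    (hB : IsUnitaryDesign 4 μB) (hC : IsUnitaryDesign 4 μC) {I I' : Fin 4 → Fin N}
    (hI : I ∈ quads N) (hI' : I' ∈ quads N) :
    |expect N μA μB μC ρ fun s => sample I s * sample I' s| ≤ 500 ^ 3 *
      (overlapFactor d I I' 1 * (overlapFactor d I I' 2 * overlapFactor d I I' 3)) := by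
  have := hA.isProbabilityMeasure
  have := hB.isProbabilityMeasure
  have := hC.isProbabilityMeasure
  have hd := hρ.dim_pos
  have hm := strictMono_of_mem_quads hI
  have hm' := strictMono_of_mem_quads hI'
  have key : ∀ {μ : Measure (UGroup d)} [IsFiniteMeasure μ], IsUnitaryDesign 4 μ → ∀ m : Fin 4,
      0 < m → PermBounded (diagTwirl μ fun a : Fin N → Fin d =>
        X (a (I 0)) (a (I m)) * X (a (I' 0)) (a (I' m))) (500 * overlapFactor d I I' m) := by
    intro μ _ hμ m hm0
    refine permBounded_X_mul_X hμ hd (hm hm0).ne (hm' hm0).ne ?_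
    -- The reversed pair would also produce a squared kernel; it is excluded because both quadruples
    -- are increasing.
    rintro ⟨h1, h2⟩
    have h3 := hm hm0
    have h4 := hm' hm0
    rw [h1, h2] at h3
    exact lt_asymm h3 h4
  have h := abs_expect_le hρ (key hA 1 (by decide)) (key hB 2 (by decide)) (key hC 3 (by decide))
  refine (le_of_eq ?_).trans (h.trans (le_of_eq (by ring)))
  congr 2
  funext s
  simp only [sample, kernelQ]
  ring

/-- There are at most binom(N,4)² pairs, so the normalization absorbs their number and the bound is
independent of N. -/
lemma abs_contribution_le {P : (Fin 4 → Fin N) → (Fin 4 → Fin N) → Prop}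
    [∀ I I', Decidable (P I I')] {B : ℝ} (hB : 0 ≤ B)
    (h : ∀ I ∈ quads N, ∀ I' ∈ quads N, P I I' →
      |expect N μA μB μC ρ fun s => sample I s * sample I' s| ≤ B) :
    |contribution N μA μB μC ρ P| ≤ B := by
  rw [contribution, abs_mul, abs_of_nonneg (by positivity)]
  have hsum : |∑ p ∈ (quads N ×ˢ quads N).filter (fun p => P p.1 p.2),
      expect N μA μB μC ρ fun s => sample p.1 s * sample p.2 s| ≤ ((N.choose 4 : ℕ) : ℝ) ^ 2 * B := by
    refine (Finset.abs_sum_le_sum_abs _ _).trans ((Finset.sum_le_card_nsmul _ _ B ?_).trans ?_)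
    · intro p hp
      obtain ⟨hp1, hp2⟩ := Finset.mem_filter.1 hp
      obtain ⟨hI, hI'⟩ := Finset.mem_product.1 hp1
      exact h _ hI _ hI' hp2
    · rw [nsmul_eq_mul]
      refine mul_le_mul_of_nonneg_right ?_ hB
      have := Finset.card_filter_le (quads N ×ˢ quads N) (fun p => P p.1 p.2)
      rw [Finset.card_product, card_quads, ← pow_two] at this
      exact_mod_cast this
  -- For N < 4 the prefactor is the inverse of zero, which is zero.
  rcases (Nat.cast_nonneg (N.choose 4) : (0 : ℝ) ≤ _).eq_or_lt with h0 | h0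
  · rw [← h0]
    simpa using hB
  · rw [inv_mul_le_iff₀ (by positivity)]
    exact hsum

section Bounds

variable (hρ : IsState ρ) (hA : IsUnitaryDesign 4 μA) (hB : IsUnitaryDesign 4 μB)
  (hC : IsUnitaryDesign 4 μC)

include hρ hA hB hC

/-- The exponent is the number of coincidences minus one, in truncated subtraction: 0, 0, 1, 2 for m
= 8, 7, 6, 5. -/
lemma abs_GamLead_le_pow (m r : ℕ) :
    |GamLead m r N μA μB μC ρ| ≤ 500 ^ 3 * (d : ℝ) ^ (8 - m - 1) := by
  refine abs_contribution_le (by positivity) fun I hI I' hI' h =>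
    (abs_expect_sample_mul_le hρ hA hB hC hI hI').trans ?_
  refine mul_le_mul_of_nonneg_left ((overlapFactor_prod_le hρ.dim_pos hI).trans (le_of_eq ?_))
    (by norm_num)
  congr 1
  have := h.1
  omega

lemma abs_GamLead_le_of_ne_two (m : ℕ) {r : ℕ} (hr : r ≠ 2) :
    |GamLead m r N μA μB μC ρ| ≤ 500 ^ 3 := by
  refine abs_contribution_le (by norm_num) fun I hI I' hI' h =>
    (abs_expect_sample_mul_le hρ hA hB hC hI hI').trans ?_
  rw [overlapFactor_prod_of_leading (by rw [h.2]; exact hr), mul_one]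

lemma abs_Gam_le_pow (m : ℕ) : |Gam m N μA μB μC ρ| ≤ 500 ^ 3 * (d : ℝ) ^ (8 - m - 1) := by
  refine abs_contribution_le (by positivity) fun I hI I' hI' h =>
    (abs_expect_sample_mul_le hρ hA hB hC hI hI').trans ?_
  refine mul_le_mul_of_nonneg_left ((overlapFactor_prod_le hρ.dim_pos hI).trans (le_of_eq ?_))
    (by norm_num)
  congr 1
  omega

end Bounds

lemma Gam_four_eq : Gam 4 N μA μB μC ρ = (((N.choose 4 : ℕ) : ℝ) ^ 2)⁻¹ *
    ∑ I ∈ quads N, expect N μA μB μC ρ fun s => sample I s * sample I s := by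
  rw [Gam, contribution]
  congr 1
  symm
  refine Finset.sum_bij (fun I _ => (I, I)) ?_ ?_ ?_ ?_
  · intro I hI
    exact Finset.mem_filter.2 ⟨Finset.mem_product.2 ⟨hI, hI⟩, by simp [coincidences_self hI]⟩
  · intro I _ I' _ h
    exact congrArg Prod.fst h
  · rintro ⟨I, I'⟩ h
    obtain ⟨h1, h2⟩ := Finset.mem_filter.1 h
    obtain ⟨hI, hI'⟩ := Finset.mem_product.1 h1
    have := eq_of_coincidences_eq_four hI hI' (by simpa using h2)
    exact ⟨I, hI, Prod.ext rfl this⟩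
  · intro I _
    rfl

/-- Only the binom(N,4) diagonal pairs occur, against the normalization binom(N,4)², and each
contributes between d³ and 500³ d³. -/
lemma Gam_four_bounds (hN : 4 ≤ N) (hρ : IsState ρ) (hA : IsUnitaryDesign 4 μA)
    (hB : IsUnitaryDesign 4 μB) (hC : IsUnitaryDesign 4 μC) :
    1 * (d : ℝ) ^ 3 / (N.choose 4 : ℝ) ≤ Gam 4 N μA μB μC ρ ∧
      Gam 4 N μA μB μC ρ ≤ 500 ^ 3 * (d : ℝ) ^ 3 / (N.choose 4 : ℝ) := by
  have := hA.isProbabilityMeasure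
  have := hB.isProbabilityMeasure
  have := hC.isProbabilityMeasure
  have hN0 : (0 : ℝ) < (N.choose 4 : ℝ) := by exact_mod_cast Nat.choose_pos hN
  rw [Gam_four_eq]
  constructor
  · have h : ((N.choose 4 : ℕ) : ℝ) * (d : ℝ) ^ 3 ≤
        ∑ I ∈ quads N, expect N μA μB μC ρ fun s => sample I s * sample I s := by
      rw [← card_quads, ← nsmul_eq_mul]
      exact Finset.card_nsmul_le_sum _ _ _ fun I hI =>
        cube_le_expect_sample_sq hρ (strictMono_of_mem_quads hI).injective
    refine le_trans (le_of_eq ?_) (mul_le_mul_of_nonneg_left h (by positivity))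
    field_simp
  · have h : ∑ I ∈ quads N, (expect N μA μB μC ρ fun s => sample I s * sample I s) ≤
        ((N.choose 4 : ℕ) : ℝ) * (500 ^ 3 * (d : ℝ) ^ 3) := by
      rw [← card_quads, ← nsmul_eq_mul]
      refine Finset.sum_le_card_nsmul _ _ _ fun I hI => (le_abs_self _).trans
        ((abs_expect_sample_mul_le hρ hA hB hC hI hI).trans ?_)
      refine mul_le_mul_of_nonneg_left ((overlapFactor_prod_le hρ.dim_pos hI).trans (le_of_eq ?_))
        (by norm_num)
      rw [coincidences_self hI]
    refine le_trans (mul_le_mul_of_nonneg_left h (by positivity)) (le_of_eq ?_)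
    field_simp

lemma expect_estimator_sq [IsProbabilityMeasure μA] [IsProbabilityMeasure μB]
    [IsProbabilityMeasure μC] :
    expect N μA μB μC ρ (fun s => estimator s ^ 2) = (((N.choose 4 : ℕ) : ℝ) ^ 2)⁻¹ *
      ∑ p ∈ quads N ×ˢ quads N, expect N μA μB μC ρ fun s => sample p.1 s * sample p.2 s := by
  rw [← expect_sum, ← expect_const_mul]
  congr 1
  funext s
  rw [estimator, mul_pow, pow_two (∑ I ∈ quads N, sample I s), Finset.sum_mul_sum,
    Finset.sum_product, inv_pow]

lemma expect_estimator_sq_eq_sum [IsProbabilityMeasure μA] [IsProbabilityMeasure μB]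
    [IsProbabilityMeasure μC] :
    expect N μA μB μC ρ (fun s => estimator s ^ 2) =
      Gam 8 N μA μB μC ρ +
      (GamLead 7 2 N μA μB μC ρ + GamLead 7 1 N μA μB μC ρ + GamLead 7 0 N μA μB μC ρ) +
      (GamLead 6 2 N μA μB μC ρ + GamLead 6 1 N μA μB μC ρ + GamLead 6 0 N μA μB μC ρ) +
      (GamLead 5 2 N μA μB μC ρ + GamLead 5 1 N μA μB μC ρ + GamLead 5 0 N μA μB μC ρ) +
      Gam 4 N μA μB μC ρ := by
  rw [expect_estimator_sq]
  simp only [Gam, GamLead, contribution, ← mul_add, Finset.sum_filter, ← Finset.sum_add_distrib]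
  congr 1
  refine Finset.sum_congr rfl fun p _ => ?_
  have hc : coincidences p.1 p.2 ≤ 4 := coincidences_le
  have hl := leading_le p.1 p.2
  generalize coincidences p.1 p.2 = c at *
  generalize leading p.1 p.2 = l at *
  -- For each pair exactly one of the eleven indicators equals 1.
  interval_cases c <;> interval_cases l <;> simp

lemma sum_abs_terms_le (hρ : IsState ρ) (hA : IsUnitaryDesign 4 μA) (hB : IsUnitaryDesign 4 μB)
    (hC : IsUnitaryDesign 4 μC) :
    |Gam 8 N μA μB μC ρ| +
      (|GamLead 7 2 N μA μB μC ρ| + |GamLead 7 1 N μA μB μC ρ| + |GamLead 7 0 N μA μB μC ρ|) +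
      (|GamLead 6 2 N μA μB μC ρ| + |GamLead 6 1 N μA μB μC ρ| + |GamLead 6 0 N μA μB μC ρ|) +
      (|GamLead 5 2 N μA μB μC ρ| + |GamLead 5 1 N μA μB μC ρ| + |GamLead 5 0 N μA μB μC ρ|) ≤
      10 * 500 ^ 3 * (d : ℝ) ^ 2 := by
  have hd1 : (1 : ℝ) ≤ d := by exact_mod_cast hρ.dim_pos
  have h8 := abs_Gam_le_pow (N := N) hρ hA hB hC 8
  have h7 := abs_GamLead_le_pow (N := N) hρ hA hB hC 7 2
  have h6 := abs_GamLead_le_pow (N := N) hρ hA hB hC 6 2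
  have h5 := abs_GamLead_le_pow (N := N) hρ hA hB hC 5 2
  have h1 := fun m => abs_GamLead_le_of_ne_two (N := N) hρ hA hB hC m (r := 1) (by norm_num)
  have h0 := fun m => abs_GamLead_le_of_ne_two (N := N) hρ hA hB hC m (r := 0) (by norm_num)
  norm_num at h8 h7 h6 h5 h1 h0 ⊢
  nlinarith [h1 7, h1 6, h1 5, h0 7, h0 6, h0 5]

end Terms

end CorrelationOverlap

end

theorem mainTheorem7 :
    -- the variance terms are exactly the pieces of the second moment of the estimator
    (∀ (d N : ℕ) (ρ : Matrix (Outcome d) (Outcome d) ℂ) (μA μB μC : Measure (UGroup d)),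
      IsState ρ → IsUnitaryDesign 4 μA → IsUnitaryDesign 4 μB → IsUnitaryDesign 4 μC →
      expect N μA μB μC ρ (fun s => estimator s ^ 2) =
        Gam 8 N μA μB μC ρ +
        (GamLead 7 2 N μA μB μC ρ + GamLead 7 1 N μA μB μC ρ + GamLead 7 0 N μA μB μC ρ) +
        (GamLead 6 2 N μA μB μC ρ + GamLead 6 1 N μA μB μC ρ + GamLead 6 0 N μA μB μC ρ) +
        (GamLead 5 2 N μA μB μC ρ + GamLead 5 1 N μA μB μC ρ + GamLead 5 0 N μA μB μC ρ) +
        Gam 4 N μA μB μC ρ) ∧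
    -- the scaling of each term in `D = d ^ 3`, with absolute constants
    (∃ c C : ℝ, 0 < c ∧ 0 < C ∧
      ∀ (d N : ℕ) (ρ : Matrix (Outcome d) (Outcome d) ℂ) (μA μB μC : Measure (UGroup d)),
        4 ≤ N → IsState ρ →
        IsUnitaryDesign 4 μA → IsUnitaryDesign 4 μB → IsUnitaryDesign 4 μC →
        |Gam 8 N μA μB μC ρ| ≤ C ∧
        |GamLead 7 2 N μA μB μC ρ| ≤ C ∧
        |GamLead 7 1 N μA μB μC ρ| ≤ C ∧
        |GamLead 7 0 N μA μB μC ρ| ≤ C ∧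
        |GamLead 6 2 N μA μB μC ρ| ≤ C * ((d : ℝ) ^ 3) ^ (1 / 3 : ℝ) ∧
        |GamLead 6 1 N μA μB μC ρ| ≤ C ∧
        |GamLead 6 0 N μA μB μC ρ| ≤ C ∧
        |GamLead 5 2 N μA μB μC ρ| ≤ C * ((d : ℝ) ^ 3) ^ (2 / 3 : ℝ) ∧
        |GamLead 5 1 N μA μB μC ρ| ≤ C ∧
        |GamLead 5 0 N μA μB μC ρ| ≤ C ∧
        c * (d : ℝ) ^ 3 / (N.choose 4 : ℝ) ≤ Gam 4 N μA μB μC ρ ∧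
        Gam 4 N μA μB μC ρ ≤ C * (d : ℝ) ^ 3 / (N.choose 4 : ℝ)) ∧
    -- the four-coincidence term dominates all the others together as `D → ∞`
    (∀ N : ℕ, 4 ≤ N → ∀ ε : ℝ, 0 < ε → ∃ d₀ : ℕ,
      ∀ (d : ℕ) (ρ : Matrix (Outcome d) (Outcome d) ℂ) (μA μB μC : Measure (UGroup d)),
        d₀ ≤ d → IsState ρ →
        IsUnitaryDesign 4 μA → IsUnitaryDesign 4 μB → IsUnitaryDesign 4 μC →
        |Gam 8 N μA μB μC ρ| +
        (|GamLead 7 2 N μA μB μC ρ| + |GamLead 7 1 N μA μB μC ρ| + |GamLead 7 0 N μA μB μC ρ|) +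
        (|GamLead 6 2 N μA μB μC ρ| + |GamLead 6 1 N μA μB μC ρ| + |GamLead 6 0 N μA μB μC ρ|) +
        (|GamLead 5 2 N μA μB μC ρ| + |GamLead 5 1 N μA μB μC ρ| + |GamLead 5 0 N μA μB μC ρ|)
          ≤ ε * Gam 4 N μA μB μC ρ) := by
  refine ⟨fun d N ρ μA μB μC _ hA hB hC => ?_, ⟨1, 500 ^ 3, by norm_num, by norm_num,
    fun d N ρ μA μB μC hN hρ hA hB hC => ?_⟩, fun N hN ε hε => ?_⟩
  · have := hA.isProbabilityMeasure
    have := hB.isProbabilityMeasure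
    have := hC.isProbabilityMeasure
    exact expect_estimator_sq_eq_sum
  · have h13 : ((d : ℝ) ^ 3) ^ (1 / 3 : ℝ) = d := by
      rw [← Real.rpow_natCast, ← Real.rpow_mul (Nat.cast_nonneg d)]
      norm_num
    have h23 : ((d : ℝ) ^ 3) ^ (2 / 3 : ℝ) = (d : ℝ) ^ 2 := by
      rw [← Real.rpow_natCast, ← Real.rpow_mul (Nat.cast_nonneg d)]
      norm_num
    have hpow := fun m r => abs_GamLead_le_pow (N := N) hρ hA hB hC m r
    have hlow := fun m r (hr : r ≠ 2) => abs_GamLead_le_of_ne_two (N := N) hρ hA hB hC m hr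
    rw [h13, h23]
    exact ⟨by simpa using abs_Gam_le_pow (N := N) hρ hA hB hC 8, by simpa using hpow 7 2,
      hlow 7 1 (by norm_num), hlow 7 0 (by norm_num), by simpa using hpow 6 2,
      hlow 6 1 (by norm_num), hlow 6 0 (by norm_num), by simpa using hpow 5 2,
      hlow 5 1 (by norm_num), hlow 5 0 (by norm_num), Gam_four_bounds hN hρ hA hB hC⟩
  · have hN0 : (0 : ℝ) < (N.choose 4 : ℝ) := by exact_mod_cast Nat.choose_pos hN
    -- The ten other terms total at most 10·500³ d², while Γ₄ ≥ d³/binom(N,4); the threshold makes ε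
    -- d / binom(N,4) at least 10·500³.
    refine ⟨⌈10 * 500 ^ 3 * (N.choose 4 : ℝ) / ε⌉₊, fun d ρ μA μB μC hd hρ hA hB hC => ?_⟩
    refine (sum_abs_terms_le hρ hA hB hC).trans ?_
    have hd' : 10 * 500 ^ 3 * (N.choose 4 : ℝ) ≤ (d : ℝ) * ε :=
      (div_le_iff₀ hε).1 (Nat.ceil_le.1 hd)
    calc 10 * 500 ^ 3 * (d : ℝ) ^ 2 ≤ ε * (1 * (d : ℝ) ^ 3 / (N.choose 4 : ℝ)) := by
          rw [mul_div_assoc', le_div_iff₀ hN0]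
          have := mul_le_mul_of_nonneg_right hd' (sq_nonneg (d : ℝ))
          linarith
      _ ≤ ε * Gam 4 N μA μB μC ρ :=
          mul_le_mul_of_nonneg_left (Gam_four_bounds hN hρ hA hB hC).1 hε.le
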